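/- Let $S^1=\mathbb{R}/\mathbb{Z}$ be the circle of unit circumference, and for $x,y\in S^1$ let $\vec d(x,y)\in[0,1)$ denote the clockwise distance from $x$ to $y$ (the representative of $y-x$ in $[0,1)$). Let $0<r\le 1$. For a finite subset $X\subseteq S^1$ let $f_r\colon X\to X$ be the map that sends each $x\in X$ to the point $y\in X$ with $\vec d(x,y)<r$ for which $\vec d(x,y)$ is largest, and let $\mathrm{per}(X,r)$ be the number of periodic points of $f_r$, that is, of points $x\in X$ with $f_r^{i}(x)=x$ for some $i\ge 1$. For each $n$ let $X_n$ be a set of $n$ points chosen independently and uniformly at random from $S^1$. Then $$\lim_{n\to\infty}\frac{\mathbf{E}[\mathrm{per}(X_n,r)]}{n}=\begin{cases}0 & \text{if } r \text{ is irrational},\\[2pt] \dfrac1q & \text{if } r=\dfrac pq \text{ with } p,q \text{ relatively prime positive integers}.\end{cases}$$ -/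

import Mathlib

open MeasureTheory ProbabilityTheory Filter Topology

/-- The clockwise distance from `x` to `y` on the circle `ℝ / ℤ` of unit circumference: the unique
representative of `y - x` in `[0, 1)`. The clockwise direction is that of `x ↦ x + t`, `t ≥ 0`. -/
noncomputable def cwDist (x y : UnitAddCircle) : ℝ :=
  (AddCircle.equivIco (1 : ℝ) 0 (y - x) : ℝ)

/-- In a finite set `X` there is a point of the arc `[x, x + r)` that is clockwise furthest
from `x`. -/
theorem exists_cw_furthest (X : Set UnitAddCircle) [Finite X] {r : ℝ} (hr : 0 < r) (x : X) :
    ∃ y : X, cwDist x y < r ∧ ∀ z : X, cwDist x z < r → cwDist x z ≤ cwDist x y := by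
  have hx : cwDist x x < r := by
    have h : cwDist (x : UnitAddCircle) x = 0 := by
      have h0 : (0 : ℝ) ∈ Set.Ico (0 : ℝ) (0 + 1) := by simp
      have h1 := AddCircle.equivIco_coe_of_mem (p := (1 : ℝ)) (a := 0) h0
      simpa [cwDist] using h1
    rwa [h]
  obtain ⟨y, hy, hmax⟩ := Set.exists_max_image {y : X | cwDist x y < r}
    (fun y : X => cwDist x y) (Set.toFinite _) ⟨x, hx⟩
  exact ⟨y, hy, fun z hz => hmax z hz⟩

/-- The map `f_r : X → X` on a finite subset `X` of the circle: it sends `x` to the element of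
`X ∩ [x, x + r)` that is clockwise furthest from `x`. (That element is unique, because
`y ↦ cwDist x y` is injective.) -/
noncomputable def cyclicMap (X : Set UnitAddCircle) [Finite X] {r : ℝ} (hr : 0 < r) (x : X) : X :=
  (exists_cw_furthest X hr x).choose

/-- The number `per(X, r)` of periodic points of `f_r : X → X`, i.e. of the `x` with
`f_r^[i] x = x` for some `i ≥ 1`. -/
noncomputable def numPeriodic (X : Set UnitAddCircle) [Finite X] {r : ℝ} (hr : 0 < r) : ℕ :=
  (Function.periodicPts (cyclicMap X hr)).ncard

/-! Take `M` disjoint arcs of equal length, each the previous one rotated by `r`. A point in them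
has a colour in `ZMod M` (its arc) and an offset within the arc. When the arcs are no longer than
`r`, a point of colour `j` is sent by `f_r` to the next point of colour `j + 1` in order of
decreasing offset, if there is one. So cycles can be followed by scanning the points in that order
while coalescing particles on `ZMod M` hop from `c` to `c + 1` whenever a letter `c` is read.
Starting from all sites occupied, every periodic point in the arcs is a hit
(`IsWindowed.card_le_scanCount`).

Moving points independently from arc to arc preserves the uniform law, so given the offsets the
colours are independent and uniform. A potential built from the numbers of arcs of `ZMod M` that
meet the occupied set shows that coalescence leaves few particles (`scanPotential_drift`), which
bounds the mean number of hits (`sum_scanCount_le`).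

If `r = p/q`, then `q` arcs of length `1/q` tile the circle and close up under rotation, and the
hits number at most `n/q + O(1)` on average. Conversely, a single particle started at a suitable
site hits only periodic points. That site depends on the points, but each single particle has `n/q`
hits on average, as many up to `O(1)` as the full system, so the choice costs only `O(1)`.

If `r` is irrational, `D ^ 3` short arcs along an orbit of the rotation are used. The orbit does not
close up, so site `0` is kept occupied; the density of hits is still at most `2 / D`. These arcs
need not cover the circle, and averaging over translates accounts for all the points. -/

/-! ### Coalescing particles on a cycle and the drift of their potential -/

/-- One step of the scanning automaton on subsets of `ZMod M`: reading a letter `c ∈ S` moves the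
particle at `c` to `c + 1` (particles coalesce), and the sites of `B` are refilled. -/
def scanStep {M : ℕ} (B S : Finset (ZMod M)) (c : ZMod M) : Finset (ZMod M) :=
  if c ∈ S then insert (c + 1) (S.erase c) ∪ B else S

/-- The number of letters of a word that hit an occupied site of the scanning automaton. -/
def scanCount {M : ℕ} (B : Finset (ZMod M)) : Finset (ZMod M) → List (ZMod M) → ℕ
  | _, [] => 0
  | S, c :: l => (if c ∈ S then 1 else 0) + scanCount B (scanStep B S c) l

/-- The indicator that the arc `{a, a + 1, …, a + d - 1}` meets `S`. -/
noncomputable def arcHit {M : ℕ} (S : Finset (ZMod M)) (a : ZMod M) (d : ℕ) : ℝ :=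
  open Classical in if ∃ i < d, a + (i : ZMod M) ∈ S then 1 else 0

/-- The number of arcs of length `d` that meet `S`. -/
noncomputable def arcCount {M : ℕ} [NeZero M] (S : Finset (ZMod M)) (d : ℕ) : ℝ :=
  ∑ a, arcHit S a d

/-- A potential function whose drift controls the number of occupied sites. -/
noncomputable def scanPotential {M : ℕ} [NeZero M] (D : ℕ) (S : Finset (ZMod M)) : ℝ :=
  ∑ d ∈ Finset.range D, ((D : ℝ) - d) * arcCount S d

section Automaton

variable {M : ℕ}

theorem subset_scanStep {B S : Finset (ZMod M)} (h : B ⊆ S) (c : ZMod M) : B ⊆ scanStep B S c := by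
  unfold scanStep
  split_ifs
  · exact Finset.subset_union_right
  · exact h

theorem scanStep_mono {B S T : Finset (ZMod M)} (hB : B ⊆ T) (h : S ⊆ T) (c : ZMod M) :
    scanStep B S c ⊆ scanStep B T c := by
  intro x hx
  have h1 : x ∈ S → x ∈ T := fun hx => h hx
  have h2 : c ∈ S → c ∈ T := fun hx => h hx
  have h3 : x ∈ B → x ∈ T := fun hx => hB hx
  unfold scanStep at *
  split_ifs at * <;> grind

/-- Coalescence makes the system attractive: extra particles never destroy a hit. This compares one
particle with the full system. -/
theorem scanCount_mono {B : Finset (ZMod M)} (l : List (ZMod M)) :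
    ∀ {S T : Finset (ZMod M)}, B ⊆ T → S ⊆ T → scanCount B S l ≤ scanCount B T l := by
  induction l with
  | nil => intros; simp [scanCount]
  | cons c l ih =>
    intro S T hB h
    have h1 := ih (subset_scanStep hB c) (scanStep_mono hB h c)
    have h2 : c ∈ S → c ∈ T := fun hx => h hx
    simp only [scanCount]
    split_ifs <;> grind

theorem arcHit_nonneg (S : Finset (ZMod M)) (a : ZMod M) (d : ℕ) : 0 ≤ arcHit S a d := by
  unfold arcHit; split_ifs <;> norm_num

theorem arcHit_le_one (S : Finset (ZMod M)) (a : ZMod M) (d : ℕ) : arcHit S a d ≤ 1 := by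
  unfold arcHit; split_ifs <;> norm_num

theorem arcHit_zero (S : Finset (ZMod M)) (a : ZMod M) : arcHit S a 0 = 0 := by
  simp [arcHit]

theorem arcHit_one (S : Finset (ZMod M)) (a : ZMod M) :
    arcHit S a 1 = if a ∈ S then 1 else 0 := by
  simp [arcHit]

theorem arcHit_eq_one {S : Finset (ZMod M)} {a : ZMod M} {d : ℕ}
    (h : ∃ i < d, a + (i : ZMod M) ∈ S) : arcHit S a d = 1 := by
  simp [arcHit, h]

theorem arcHit_eq_zero {S : Finset (ZMod M)} {a : ZMod M} {d : ℕ}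
    (h : ∀ i < d, a + (i : ZMod M) ∉ S) : arcHit S a d = 0 := by
  unfold arcHit
  rw [if_neg]
  push Not
  exact h

theorem natCast_ne_of_lt {i j : ℕ} (hi : i < M) (hj : j < M) (h : i ≠ j) :
    (i : ZMod M) ≠ j := by
  intro h'
  rw [ZMod.natCast_eq_natCast_iff', Nat.mod_eq_of_lt hi, Nat.mod_eq_of_lt hj] at h'
  exact h h'

/-- An occupied arc becomes empty only if its sole particle sits at the last site and that letter is
read; an empty arc becomes occupied only through the letter `a - 1`. These two events give the
differences of `arcHit` for lengths `d - 1`, `d` and for `d`, `d + 1`. The sum over `B` pays for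
refilling. -/
theorem arcHit_drift [NeZero M] {B S : Finset (ZMod M)} (hB : B ⊆ S) (a : ZMod M) {d : ℕ}
    (hd : 1 ≤ d) (hdM : d < M) :
    2 * arcHit S a d - arcHit S (a - 1) (d + 1) - arcHit S a (d - 1)
      - ∑ i ∈ Finset.range d, (if a + (i : ZMod M) ∈ B then (1 : ℝ) else 0)
      ≤ ∑ c, (arcHit S a d - arcHit (scanStep B S c) a d) := by
  have hM : 0 < M := by omega
  have hsrc : 0 ≤ ∑ i ∈ Finset.range d, (if a + (i : ZMod M) ∈ B then (1 : ℝ) else 0) :=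
    Finset.sum_nonneg fun i _ => by split_ifs <;> norm_num
  by_cases hS : ∃ i < d, a + (i : ZMod M) ∈ S
  · have e1 : arcHit S a d = 1 := arcHit_eq_one hS
    have e2 : arcHit S (a - 1) (d + 1) = 1 := by
      obtain ⟨i, hi, h⟩ := hS
      refine arcHit_eq_one ⟨i + 1, by omega, ?_⟩
      push_cast
      convert h using 1
      ring
    have hnn : ∀ c, 0 ≤ arcHit S a d - arcHit (scanStep B S c) a d := fun c => by
      rw [e1]; linarith [arcHit_le_one (scanStep B S c) a d]
    have hsum : 0 ≤ ∑ c, (arcHit S a d - arcHit (scanStep B S c) a d) :=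
      Finset.sum_nonneg fun c _ => hnn c
    -- A refilled site inside the arc makes the left side nonpositive.
    by_cases hsr : ∃ i < d, a + (i : ZMod M) ∈ B
    · obtain ⟨i, hi, h⟩ := hsr
      have : (1 : ℝ) ≤ ∑ i ∈ Finset.range d, (if a + (i : ZMod M) ∈ B then (1 : ℝ) else 0) := by
        have := Finset.single_le_sum (f := fun i : ℕ => if a + (i : ZMod M) ∈ B then (1 : ℝ) else 0)
          (fun i _ => by split_ifs <;> norm_num) (Finset.mem_range.2 hi)
        simpa [h] using this
      linarith [arcHit_nonneg S a (d - 1)]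
    · push Not at hsr
      by_cases hS' : ∃ i < d - 1, a + (i : ZMod M) ∈ S
      · rw [arcHit_eq_one hS', e1, e2]
        rw [e1] at hsum
        linarith
      · push Not at hS'
        rw [arcHit_eq_zero hS', e2]
        have hlast : a + ((d - 1 : ℕ) : ZMod M) ∈ S := by
          obtain ⟨i, hi, h⟩ := hS
          have : i = d - 1 := by
            by_contra hne
            exact hS' i (by omega) h
          exact this ▸ h
        -- The particle leaves to `a + d`, which is outside the arc because `d < M`.
        have hz : arcHit (scanStep B S (a + ((d - 1 : ℕ) : ZMod M))) a d = 0 := by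
          refine arcHit_eq_zero fun i hi hmem => ?_
          rw [scanStep, if_pos hlast] at hmem
          simp only [Finset.mem_union, Finset.mem_insert, Finset.mem_erase] at hmem
          rcases hmem with (h | ⟨h1, h2⟩) | h
          · rw [add_assoc, add_right_inj] at h
            have : ((d - 1 : ℕ) : ZMod M) + 1 = (d : ℕ) := by
              rw [← Nat.cast_succ]; congr 1; omega
            rw [this] at h
            exact natCast_ne_of_lt (by omega) hdM (by omega) h
          · by_cases h3 : i = d - 1
            · exact h1 (by rw [h3])
            · exact hS' i (by omega) h2
          · exact hsr i hi h
        have := Finset.single_le_sum (f := fun c => arcHit S a d - arcHit (scanStep B S c) a d)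
          (fun c _ => hnn c) (Finset.mem_univ (a + ((d - 1 : ℕ) : ZMod M)))
        simp only [hz] at this
        linarith
  · push Not at hS
    have e1 : arcHit S a d = 0 := arcHit_eq_zero hS
    have e3 : arcHit S a (d - 1) = 0 := arcHit_eq_zero fun i hi => hS i (by omega)
    rw [e1, e3]
    have key : ∀ c, c ≠ a - 1 → arcHit (scanStep B S c) a d = 0 := by
      intro c hc
      refine arcHit_eq_zero fun i hi hmem => ?_
      unfold scanStep at hmem
      split_ifs at hmem with hcS
      · simp only [Finset.mem_union, Finset.mem_insert, Finset.mem_erase] at hmem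
        rcases hmem with (h | ⟨h1, h2⟩) | h
        · rcases Nat.eq_zero_or_pos i with rfl | hi0
          · apply hc
            rw [eq_sub_iff_add_eq, ← h]; simp
          · refine hS (i - 1) (by omega) ?_
            have : a + ((i - 1 : ℕ) : ZMod M) = c := by
              rw [Nat.cast_sub hi0]
              push_cast
              rw [← add_sub_assoc, h]; ring
            rwa [this]
        · exact hS i hi h2
        · exact hS i hi (hB h)
      · exact hS i hi hmem
    have hsingle : ∑ c, ((0 : ℝ) - arcHit (scanStep B S c) a d)
        = 0 - arcHit (scanStep B S (a - 1)) a d := by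
      refine Finset.sum_eq_single _ (fun c _ hc => ?_) (by simp)
      rw [key c hc]; simp
    rw [hsingle]
    by_cases ha : a - 1 ∈ S
    · have : arcHit S (a - 1) (d + 1) = 1 := arcHit_eq_one ⟨0, by omega, by simpa using ha⟩
      linarith [arcHit_le_one (scanStep B S (a - 1)) a d]
    · have : scanStep B S (a - 1) = S := by simp [scanStep, ha]
      rw [this, e1]
      linarith [arcHit_nonneg S (a - 1) (d + 1)]

theorem arcCount_nonneg [NeZero M] (S : Finset (ZMod M)) (d : ℕ) : 0 ≤ arcCount S d :=
  Finset.sum_nonneg fun _ _ => arcHit_nonneg _ _ _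

theorem arcCount_le [NeZero M] (S : Finset (ZMod M)) (d : ℕ) : arcCount S d ≤ M := by
  refine (Finset.sum_le_sum fun a _ => arcHit_le_one S a d).trans ?_
  simp [ZMod.card]

theorem arcCount_zero [NeZero M] (S : Finset (ZMod M)) : arcCount S 0 = 0 := by
  simp [arcCount, arcHit_zero]

theorem arcCount_one [NeZero M] (S : Finset (ZMod M)) : arcCount S 1 = S.card := by
  simp [arcCount, arcHit_one]

/-- Summed over `a`, the drift becomes a discrete second difference in `d`; each site of `B` lies in
`d` of the arcs. -/
theorem arcCount_drift [NeZero M] {B S : Finset (ZMod M)} (hB : B ⊆ S) {d : ℕ}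
    (hd : 1 ≤ d) (hdM : d < M) :
    2 * arcCount S d - arcCount S (d + 1) - arcCount S (d - 1) - d * B.card
      ≤ ∑ c, (arcCount S d - arcCount (scanStep B S c) d) := by
  have h := Finset.sum_le_sum fun a (_ : a ∈ (Finset.univ : Finset (ZMod M))) =>
    arcHit_drift hB a hd hdM
  rw [Finset.sum_comm] at h
  simp only [Finset.sum_sub_distrib, ← Finset.mul_sum] at h
  have h1 : ∑ a, arcHit S (a - 1) (d + 1) = arcCount S (d + 1) :=
    Fintype.sum_equiv (Equiv.subRight (1 : ZMod M)) _ _ fun a => rfl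
  have h2 : ∑ a : ZMod M, ∑ i ∈ Finset.range d, (if a + (i : ZMod M) ∈ B then (1 : ℝ) else 0)
      = d * B.card := by
    rw [Finset.sum_comm]
    have : ∀ i ∈ Finset.range d, ∑ a : ZMod M, (if a + (i : ZMod M) ∈ B then (1 : ℝ) else 0)
        = B.card := by
      intro i _
      rw [Fintype.sum_equiv (Equiv.addRight (i : ZMod M))
        (fun a => if a + (i : ZMod M) ∈ B then (1 : ℝ) else 0)
        (fun a => if a ∈ B then (1 : ℝ) else 0) (fun a => by simp only [Equiv.coe_addRight]; congr)]
      simp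
    rw [Finset.sum_congr rfl this]
    simp
  rw [h1, h2] at h
  simpa [arcCount, Finset.sum_sub_distrib] using h

/-- Summation by parts twice. With `N = arcCount S` it isolates `N 1`, the number of particles,
which explains the weights `D - d` of the potential. -/
theorem sum_second_difference (N : ℕ → ℝ) (h0 : N 0 = 0) (D : ℕ) :
    (D + 1 : ℝ) * N 1 = N (D + 1) + ∑ d ∈ Finset.range D,
      ((D : ℝ) - d) * (2 * N (d + 1) - N (d + 2) - N d) := by
  have aux : ∀ D : ℕ, ∑ d ∈ Finset.range D, (2 * N (d + 1) - N (d + 2) - N d)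
      = N 1 - N (D + 1) + N D := by
    intro D
    induction D with
    | zero => simp [h0]
    | succ D ih => rw [Finset.sum_range_succ, ih]; ring
  induction D with
  | zero => simp
  | succ D ih =>
    have e : ∑ d ∈ Finset.range (D + 1),
        (((D + 1 : ℕ) : ℝ) - d) * (2 * N (d + 1) - N (d + 2) - N d)
        = ∑ d ∈ Finset.range D, ((D : ℝ) - d) * (2 * N (d + 1) - N (d + 2) - N d)
          + ∑ d ∈ Finset.range (D + 1), (2 * N (d + 1) - N (d + 2) - N d) := by
      rw [Finset.sum_range_succ, Finset.sum_range_succ _ D, ← add_assoc, ← Finset.sum_add_distrib]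
      congr 1
      · refine Finset.sum_congr rfl fun d _ => ?_
        push_cast; ring
      · push_cast; ring
    rw [e, aux]
    push_cast
    linarith

theorem scanPotential_nonneg [NeZero M] (D : ℕ) (S : Finset (ZMod M)) : 0 ≤ scanPotential D S := by
  refine Finset.sum_nonneg fun d hd => mul_nonneg ?_ (arcCount_nonneg _ _)
  have : (d : ℝ) < D := by exact_mod_cast Finset.mem_range.1 hd
  linarith

theorem scanPotential_le [NeZero M] (D : ℕ) (S : Finset (ZMod M)) :
    scanPotential D S ≤ D * D * M := by
  have : scanPotential D S ≤ ∑ d ∈ Finset.range D, (D : ℝ) * M := by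
    refine Finset.sum_le_sum fun d hd => mul_le_mul ?_ (arcCount_le _ _) (arcCount_nonneg _ _) ?_
    · have : (0 : ℝ) ≤ d := by positivity
      linarith
    · positivity
  simpa [mul_assoc] using this

/-- The weighted second differences collapse to `D * N 1 - N D` for `N = arcCount S`, where `N 1 =
S.card` and `N D ≤ M`: many particles force the potential to fall. -/
theorem scanPotential_drift [NeZero M] {B S : Finset (ZMod M)} (hB : B ⊆ S) {D : ℕ}
    (hD : 1 ≤ D) (hDM : D ≤ M) :
    D * (S.card : ℝ) - M - D ^ 3 * B.card
      ≤ ∑ c, (scanPotential D S - scanPotential D (scanStep B S c)) := by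
  -- The term `d = 0` of the potential vanishes, so the sum is reindexed from `d = 1`.
  obtain ⟨E, rfl⟩ : ∃ E, D = E + 1 := ⟨D - 1, by omega⟩
  have hV : ∀ T : Finset (ZMod M), scanPotential (E + 1) T
      = ∑ d ∈ Finset.range E, ((E : ℝ) - d) * arcCount T (d + 1) := by
    intro T
    rw [scanPotential, Finset.sum_range_succ']
    simp [arcCount_zero]
  have h1 : ∑ d ∈ Finset.range E, ((E : ℝ) - d) *
      (2 * arcCount S (d + 1) - arcCount S (d + 2) - arcCount S d - (d + 1 : ℕ) * B.card)
      ≤ ∑ d ∈ Finset.range E, ((E : ℝ) - d) *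
        ∑ c, (arcCount S (d + 1) - arcCount (scanStep B S c) (d + 1)) := by
    refine Finset.sum_le_sum fun d hd => ?_
    have hd' := Finset.mem_range.1 hd
    refine mul_le_mul_of_nonneg_left ?_ ?_
    · exact arcCount_drift hB (d := d + 1) (by omega) (by omega)
    · have : (d : ℝ) < E := by exact_mod_cast hd'
      linarith
  have h2 := sum_second_difference (arcCount S) (arcCount_zero S) E
  have h3 : ∑ d ∈ Finset.range E, ((E : ℝ) - d) * (((d + 1 : ℕ) : ℝ) * B.card)
      ≤ ((E + 1 : ℕ) : ℝ) ^ 3 * B.card := by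
    have : ∑ d ∈ Finset.range E, ((E : ℝ) - d) * (((d + 1 : ℕ) : ℝ) * B.card)
        ≤ ∑ d ∈ Finset.range E, ((E + 1 : ℕ) : ℝ) * (((E + 1 : ℕ) : ℝ) * B.card) := by
      refine Finset.sum_le_sum fun d hd => ?_
      have hd' : (d : ℝ) < E := by exact_mod_cast Finset.mem_range.1 hd
      have h0 : (0 : ℝ) ≤ d := by positivity
      gcongr
      · push_cast; linarith
      · exact (Finset.mem_range.1 hd).le
    refine this.trans ?_
    simp only [Finset.sum_const, Finset.card_range, nsmul_eq_mul]
    have : (E : ℝ) ≤ ((E + 1 : ℕ) : ℝ) := by push_cast; linarith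
    calc (E : ℝ) * (((E + 1 : ℕ) : ℝ) * (((E + 1 : ℕ) : ℝ) * B.card))
        ≤ ((E + 1 : ℕ) : ℝ) * (((E + 1 : ℕ) : ℝ) * (((E + 1 : ℕ) : ℝ) * B.card)) := by gcongr
      _ = _ := by ring
  have h4 : ∑ d ∈ Finset.range E, ((E : ℝ) - d) *
      (2 * arcCount S (d + 1) - arcCount S (d + 2) - arcCount S d - (d + 1 : ℕ) * B.card)
      = ∑ d ∈ Finset.range E, ((E : ℝ) - d) *
        (2 * arcCount S (d + 1) - arcCount S (d + 2) - arcCount S d)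
        - ∑ d ∈ Finset.range E, ((E : ℝ) - d) * (((d + 1 : ℕ) : ℝ) * B.card) := by
    rw [← Finset.sum_sub_distrib]
    exact Finset.sum_congr rfl fun d _ => by ring
  have h5 : ∑ d ∈ Finset.range E, ((E : ℝ) - d) *
      ∑ c, (arcCount S (d + 1) - arcCount (scanStep B S c) (d + 1))
      = ∑ c, (scanPotential (E + 1) S - scanPotential (E + 1) (scanStep B S c)) := by
    simp only [hV, ← Finset.sum_sub_distrib, Finset.mul_sum]
    rw [Finset.sum_comm]
    exact Finset.sum_congr rfl fun c _ => Finset.sum_congr rfl fun d _ => by ring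
  rw [arcCount_one] at h2
  have h6 := arcCount_le S (E + 1)
  rw [h4, h5] at h1
  push_cast at h1 h3 ⊢
  linarith

/-! ### Averages over uniformly random words -/

section Average

variable {ι : Type*} [Fintype ι] [DecidableEq ι]

/-- The letter at `i` is uniform and independent of the letters at `l`: translating the coordinate
`i` permutes the colourings and fixes `l.map c`. -/
theorem sum_comp_apply_map [NeZero M] {i : ι} {l : List ι} (hi : i ∉ l)
    (G : ZMod M → List (ZMod M) → ℝ) :
    (M : ℝ) * ∑ c : ι → ZMod M, G (c i) (l.map c) = ∑ v, ∑ c : ι → ZMod M, G v (l.map c) := by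
  have h1 : ∀ w : ZMod M, ∑ c : ι → ZMod M, G (c i) (l.map c)
      = ∑ c : ι → ZMod M, G (c i + w) (l.map c) := by
    intro w
    symm
    refine Fintype.sum_equiv (Equiv.addRight (Pi.single i w)) _ _ fun c => ?_
    have : l.map (c + Pi.single i w) = l.map c := by
      refine List.map_congr_left fun j hj => ?_
      have : j ≠ i := fun h => hi (h ▸ hj)
      simp [this]
    simp [this]
  have h2 : (M : ℝ) * ∑ c : ι → ZMod M, G (c i) (l.map c)
      = ∑ w : ZMod M, ∑ c : ι → ZMod M, G (c i + w) (l.map c) := by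
    rw [← Finset.sum_congr rfl fun w _ => h1 w]
    simp [ZMod.card]
  rw [h2, Finset.sum_comm]
  rw [Finset.sum_comm (γ := ZMod M)]
  refine Finset.sum_congr rfl fun c _ => ?_
  exact Fintype.sum_equiv (Equiv.addLeft (c i)) _ _ fun w => rfl

theorem sum_scanCount_cons [NeZero M] (B S : Finset (ZMod M)) {i : ι} {l : List ι} (hi : i ∉ l) :
    (M : ℝ) * ∑ c : ι → ZMod M, (scanCount B S ((i :: l).map c) : ℝ)
      = S.card * M ^ Fintype.card ι
        + ∑ v, ∑ c : ι → ZMod M, (scanCount B (scanStep B S v) (l.map c) : ℝ) := by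
  have := sum_comp_apply_map (M := M) hi (fun v l' => ((if v ∈ S then 1 else 0 : ℕ) : ℝ)
    + (scanCount B (scanStep B S v) l' : ℝ))
  simp only [List.map_cons, scanCount, Nat.cast_add]
  rw [this]
  simp only [Finset.sum_add_distrib]
  congr 1
  simp [ZMod.card]

/-- A letter is a hit with probability `S.card / M`, and by the drift bound `D` times this is at
most `1 + D ^ 3 * B.card / M` plus the mean drop of the potential. The drops telescope along the
word. -/
theorem sum_scanCount_le [NeZero M] (B : Finset (ZMod M)) {D : ℕ} (hD : 1 ≤ D) (hDM : D ≤ M)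
    (l : List ι) : ∀ (_ : l.Nodup) {S : Finset (ZMod M)} (_ : B ⊆ S),
    D * ∑ c : ι → ZMod M, (scanCount B S (l.map c) : ℝ)
      ≤ M ^ Fintype.card ι * (l.length * (1 + D ^ 3 * B.card / M) + scanPotential D S) := by
  have hM : (0 : ℝ) < M := by exact_mod_cast (NeZero.pos M)
  induction l with
  | nil =>
    intro _ S _
    have := scanPotential_nonneg D S
    simp only [List.map_nil, scanCount]
    simp only [Nat.cast_zero, Finset.sum_const_zero, mul_zero, List.length_nil, zero_mul, zero_add]
    positivity
  | cons i l ih =>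
    intro hl S hB
    have hl' := List.nodup_cons.1 hl
    have h1 := sum_scanCount_cons B S hl'.1
    have h2 : ∑ v, ((D : ℝ) * ∑ c : ι → ZMod M, (scanCount B (scanStep B S v) (l.map c) : ℝ))
        ≤ ∑ v : ZMod M, M ^ Fintype.card ι *
          (l.length * (1 + D ^ 3 * B.card / M) + scanPotential D (scanStep B S v)) :=
      Finset.sum_le_sum fun v _ => ih hl'.2 (subset_scanStep hB v)
    have h3 := scanPotential_drift hB hD hDM
    rw [← Finset.mul_sum] at h2
    rw [← Finset.mul_sum, Finset.sum_add_distrib] at h2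
    rw [Finset.sum_sub_distrib] at h3
    simp only [Finset.sum_const, Finset.card_univ, ZMod.card, nsmul_eq_mul] at h2 h3
    set X := ∑ c : ι → ZMod M, (scanCount B S ((i :: l).map c) : ℝ)
    set Y := ∑ v, ∑ c : ι → ZMod M, (scanCount B (scanStep B S v) (l.map c) : ℝ)
    set Z := ∑ v, scanPotential D (scanStep B S v)
    set p : ℝ := (M : ℝ) ^ Fintype.card ι
    have hp : 0 < p := by positivity
    have h4 : p * (D * (S.card : ℝ) - M - D ^ 3 * B.card) ≤ p * (M * scanPotential D S - Z) :=
      mul_le_mul_of_nonneg_left h3 hp.le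
    have h5 : (M : ℝ) * (D ^ 3 * B.card / M) = D ^ 3 * B.card := by field_simp
    refine le_of_mul_le_mul_left ?_ hM
    have e1 : (M : ℝ) * (D * X) = D * (S.card * p) + D * Y := by
      rw [mul_left_comm, h1]; ring
    rw [e1, List.length_cons]
    push_cast
    have e2 : (M : ℝ) * (p * ((l.length + 1) * (1 + D ^ 3 * B.card / M) + scanPotential D S))
        = p * (M * (l.length * (1 + D ^ 3 * B.card / M)) + Z)
          + p * (M + M * (D ^ 3 * B.card / M) + M * scanPotential D S - Z) := by ring
    rw [e2, h5]
    nlinarith [h2, h4]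

theorem scanStep_singleton_card {S : Finset (ZMod M)} (hS : S.card = 1) (c : ZMod M) :
    (scanStep ∅ S c).card = 1 := by
  obtain ⟨s, rfl⟩ := Finset.card_eq_one.1 hS
  unfold scanStep
  split_ifs with h
  · rw [Finset.mem_singleton] at h
    simp [h]
  · simp

/-- A lone particle never disappears, so each letter hits it with probability `1 / M`. -/
theorem sum_scanCount_of_card_eq_one [NeZero M] (l : List ι) : ∀ (_ : l.Nodup)
    {S : Finset (ZMod M)} (_ : S.card = 1),
    M * ∑ c : ι → ZMod M, (scanCount ∅ S (l.map c) : ℝ) = M ^ Fintype.card ι * l.length := by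
  have hM : (0 : ℝ) < M := by exact_mod_cast (NeZero.pos M)
  induction l with
  | nil => intro _ S _; simp [scanCount]
  | cons i l ih =>
    intro hl S hS
    have hl' := List.nodup_cons.1 hl
    rw [sum_scanCount_cons ∅ S hl'.1]
    have h2 : ∀ v, ∑ c : ι → ZMod M, (scanCount ∅ (scanStep ∅ S v) (l.map c) : ℝ)
        = M ^ Fintype.card ι * l.length / M := fun v => by
      rw [eq_div_iff hM.ne', mul_comm]
      exact ih hl'.2 (scanStep_singleton_card hS v)
    rw [Finset.sum_congr rfl fun v _ => h2 v]
    simp only [Finset.sum_const, Finset.card_univ, ZMod.card, nsmul_eq_mul, List.length_cons, hS]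
    field_simp
    push_cast
    ring

end Average

/-! ### Marked letters against hits of the automaton -/

/-- By induction every letter of `P` is a hit: its site is refilled, or occupied from the start and
untouched so far, or was reached by the particle that an earlier hit `z ∈ P` pushed forward. A
particle leaves a site only when the colour of that site is read. -/
theorem card_filter_le_scanCount {ι : Type*} [DecidableEq ι] {B : Finset (ZMod M)}
    (P : Finset ι) (col : ι → ZMod M) (l : List ι) : ∀ {S : Finset (ZMod M)}, B ⊆ S → l.Nodup →
    (∀ a y b, l = a ++ y :: b → y ∈ P → col y ∈ B ∨
      (col y ∈ S ∧ ∀ x ∈ a, col x ≠ col y) ∨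
      ∃ a₁ z a₂, a = a₁ ++ z :: a₂ ∧ z ∈ P ∧ col z + 1 = col y ∧ ∀ x ∈ a₂, col x ≠ col y) →
    (l.toFinset ∩ P).card ≤ scanCount B S (l.map col) := by
  induction l with
  | nil => intros; simp
  | cons i l ih =>
    intro S hB hl H
    have hi : i ∈ P → col i ∈ S := by
      intro hi
      rcases H [] i l rfl hi with h | h | ⟨a₁, z, a₂, h, _⟩
      · exact hB h
      · exact h.1
      · simp at h
    have hl' := List.nodup_cons.1 hl
    have h1 := ih (S := scanStep B S (col i)) (subset_scanStep hB _) hl'.2 (by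
      intro a y b hab hy
      rcases H (i :: a) y b (by rw [hab]; rfl) hy with h | ⟨h, h'⟩ | ⟨a₁, z, a₂, h, hz, hc, h'⟩
      · exact Or.inl h
      · refine Or.inr (Or.inl ⟨?_, fun x hx => h' x (List.mem_cons_of_mem _ hx)⟩)
        have := h' i List.mem_cons_self
        unfold scanStep
        split_ifs
        · simp [h, Ne.symm this]
        · exact h
      · rcases a₁ with _ | ⟨j, a₁⟩
        · simp only [List.nil_append, List.cons.injEq] at h
          obtain ⟨rfl, rfl⟩ := h
          refine Or.inr (Or.inl ⟨?_, h'⟩)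
          rw [scanStep, if_pos (hi hz), ← hc]
          simp
        · simp only [List.cons_append, List.cons.injEq] at h
          exact Or.inr (Or.inr ⟨a₁, z, a₂, h.2, hz, hc, h'⟩))
    simp only [List.map_cons, scanCount, List.toFinset_cons]
    by_cases hP : i ∈ P
    · rw [Finset.insert_inter_of_mem hP, if_pos (hi hP)]
      have := Finset.card_insert_le i (l.toFinset ∩ P)
      omega
    · rw [Finset.insert_inter_of_notMem hP]
      omega

theorem scanCount_singleton_le_card {ι : Type*} [DecidableEq ι]
    (P : Finset ι) (col : ι → ZMod M) (l : List ι) : ∀ (s : ZMod M), l.Nodup →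
    (∀ a y b, l = a ++ y :: b → col y = s → (∀ x ∈ a, col x ≠ s) → y ∈ P) →
    (∀ a z b y c, l = a ++ z :: (b ++ y :: c) → z ∈ P → col y = col z + 1 →
      (∀ x ∈ b, col x ≠ col y) → y ∈ P) →
    scanCount ∅ {s} (l.map col) ≤ (l.toFinset ∩ P).card := by
  induction l with
  | nil => intros; simp [scanCount]
  | cons i l ih =>
    intro s hl H1 H2
    have hl' := List.nodup_cons.1 hl
    have H2' : ∀ a z b y c, l = a ++ z :: (b ++ y :: c) → z ∈ P → col y = col z + 1 →
      (∀ x ∈ b, col x ≠ col y) → y ∈ P := fun a z b y c h => H2 (i :: a) z b y c (by rw [h]; rfl)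
    simp only [List.map_cons, scanCount, List.toFinset_cons, Finset.mem_singleton]
    by_cases hi : col i = s
    · have hP : i ∈ P := H1 [] i l rfl hi (by simp)
      rw [Finset.insert_inter_of_mem hP, Finset.card_insert_of_notMem (by simp [hl'.1])]
      have hst : scanStep ∅ {s} (col i) = {s + 1} := by simp [scanStep, hi]
      rw [hst, if_pos hi]
      -- The particle now waits at `s + 1`, and `H2` applied to the hit `i` supplies the new `H1`.
      have := ih (s + 1) hl'.2 (fun a y b hab hy hx =>
        H2 [] i a y b (by rw [hab]; rfl) hP (by rw [hy, hi]) (by rwa [hy])) H2'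
      omega
    · have hst : scanStep ∅ {s} (col i) = {s} := by simp [scanStep, hi]
      rw [hst, if_neg hi]
      have := ih s hl'.2 (fun a y b hab hy hx =>
        H1 (i :: a) y b (by rw [hab]; rfl) hy (by
          intro x hx'
          rcases List.mem_cons.1 hx' with rfl | h
          · exact hi
          · exact hx x h)) H2'
      have h2 : (l.toFinset ∩ P).card ≤ (insert i l.toFinset ∩ P).card :=
        Finset.card_le_card (Finset.inter_subset_inter_right (Finset.subset_insert _ _))
      omega

end Automaton

/-! ### Clockwise distance and cycles of the furthest-point relation -/

theorem cwDist_nonneg (x y : UnitAddCircle) : 0 ≤ cwDist x y :=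
  (AddCircle.equivIco (1 : ℝ) 0 (y - x)).2.1

theorem add_cwDist (x y : UnitAddCircle) : x + ((cwDist x y : ℝ) : UnitAddCircle) = y := by
  rw [cwDist, AddCircle.coe_equivIco]
  abel

theorem cwDist_add_coe (x : UnitAddCircle) {t : ℝ} (h0 : 0 ≤ t) (h1 : t < 1) :
    cwDist x (x + (t : UnitAddCircle)) = t := by
  rw [cwDist, add_sub_cancel_left]
  exact AddCircle.equivIco_coe_of_mem (p := (1 : ℝ)) ⟨h0, by rwa [zero_add]⟩

theorem cwDist_inj {x y z : UnitAddCircle} (h : cwDist x y = cwDist x z) : y = z := by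
  rw [← add_cwDist x y, h, add_cwDist]

theorem measurable_cwDist_right (x : UnitAddCircle) : Measurable (cwDist x) := by
  have : Measurable fun y : UnitAddCircle => ((AddCircle.measurableEquivIco (1 : ℝ) 0 y : Set.Ico (0 : ℝ) (0 + 1)) : ℝ) :=
    measurable_subtype_coe.comp (AddCircle.measurableEquivIco (1 : ℝ) 0).measurable
  exact this.comp (measurable_id.sub_const x)

theorem Measurable.cwDist {α : Type*} [MeasurableSpace α] {f g : α → UnitAddCircle}
    (hf : Measurable f) (hg : Measurable g) : Measurable fun a => cwDist (f a) (g a) := by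
  have : Measurable fun y : UnitAddCircle => ((AddCircle.measurableEquivIco (1 : ℝ) 0 y : Set.Ico (0 : ℝ) (0 + 1)) : ℝ) :=
    measurable_subtype_coe.comp (AddCircle.measurableEquivIco (1 : ℝ) 0).measurable
  exact this.comp (hg.sub hf)

section Relation

variable {ι : Type*}

/-- `u j` is clockwise furthest from `u i` among the points of the family `u` in the arc
`[u i, u i + r)`. -/
def IsFurthest (r : ℝ) (u : ι → UnitAddCircle) (i j : ι) : Prop :=
  cwDist (u i) (u j) < r ∧ ∀ k, cwDist (u i) (u k) < r → cwDist (u i) (u k) ≤ cwDist (u i) (u j)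

theorem IsFurthest.unique {r : ℝ} {u : ι → UnitAddCircle} (hu : Function.Injective u) {i j k : ι}
    (hj : IsFurthest r u i j) (hk : IsFurthest r u i k) : j = k :=
  hu (cwDist_inj (le_antisymm (hk.2 j hj.1) (hj.2 k hk.1)))

open Classical in
/-- The indices of the points that lie on a cycle of the relation `IsFurthest`. -/
noncomputable def cycleIndices [Fintype ι] (r : ℝ) (u : ι → UnitAddCircle) : Finset ι :=
  Finset.univ.filter fun i => Relation.TransGen (IsFurthest r u) i i

theorem mem_cycleIndices [Fintype ι] {r : ℝ} {u : ι → UnitAddCircle} {i : ι} :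
    i ∈ cycleIndices r u ↔ Relation.TransGen (IsFurthest r u) i i := by
  simp [cycleIndices]

theorem exists_isFurthest_of_mem_cycleIndices [Fintype ι] {r : ℝ} {u : ι → UnitAddCircle} {i : ι}
    (h : i ∈ cycleIndices r u) : ∃ z ∈ cycleIndices r u, IsFurthest r u z i := by
  obtain ⟨z, h1, h2⟩ := Relation.TransGen.tail'_iff.1 (mem_cycleIndices.1 h)
  exact ⟨z, mem_cycleIndices.2 (Relation.TransGen.head' h2 h1), h2⟩

theorem mem_cycleIndices_of_isFurthest [Fintype ι] {r : ℝ} {u : ι → UnitAddCircle}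
    (hu : Function.Injective u) {i j : ι} (h : i ∈ cycleIndices r u) (hij : IsFurthest r u i j) :
    j ∈ cycleIndices r u := by
  obtain ⟨z, h1, h2⟩ := Relation.TransGen.head'_iff.1 (mem_cycleIndices.1 h)
  obtain rfl := hij.unique hu h1
  exact mem_cycleIndices.2 (Relation.TransGen.tail' h2 hij)

theorem transGen_iff_mem_periodicPts {α : Type*} {R : α → α → Prop} {f : α → α}
    (h : ∀ i j, R i j ↔ f i = j) (i : α) :
    Relation.TransGen R i i ↔ i ∈ Function.periodicPts f := by
  have key : ∀ i j, Relation.TransGen R i j ↔ ∃ k, f^[k + 1] i = j := by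
    intro i j
    constructor
    · intro hij
      induction hij with
      | single hb => exact ⟨0, (h _ _).1 hb⟩
      | tail _ hbc ih =>
        obtain ⟨k, hk⟩ := ih
        exact ⟨k + 1, by rw [Function.iterate_succ_apply', hk]; exact (h _ _).1 hbc⟩
    · rintro ⟨k, rfl⟩
      induction k with
      | zero => exact Relation.TransGen.single ((h _ _).2 rfl)
      | succ k ih =>
        refine ih.tail ?_
        rw [h, ← Function.iterate_succ_apply' f]
  rw [key, Function.mem_periodicPts]
  constructor
  · rintro ⟨k, hk⟩
    exact ⟨k + 1, by omega, hk⟩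
  · rintro ⟨k, hk, hk'⟩
    obtain ⟨k, rfl⟩ : ∃ m, k = m + 1 := ⟨k - 1, by omega⟩
    exact ⟨k, hk'⟩

theorem exists_isFurthest_iff [Finite ι] {r : ℝ} (hr : 0 < r) {u : ι → UnitAddCircle}
    (hu : Function.Injective u) : ∃ f : ι → ι, (∀ i j, IsFurthest r u i j ↔ f i = j) ∧
      numPeriodic (Set.range u) hr = (Function.periodicPts f).ncard := by
  set e := Equiv.ofInjective u hu
  have hsp := fun x : Set.range u => (exists_cw_furthest (Set.range u) hr x).choose_spec
  set f : ι → ι := fun i => e.symm (cyclicMap (Set.range u) hr (e i))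
  have hf : ∀ i, IsFurthest r u i (f i) := by
    intro i
    have h := hsp (e i)
    have h1 : u (f i) = (cyclicMap (Set.range u) hr (e i) : UnitAddCircle) :=
      Equiv.apply_ofInjective_symm hu _
    unfold IsFurthest
    rw [h1]
    exact ⟨h.1, fun k hk => h.2 (e k) hk⟩
  refine ⟨f, fun i j => ⟨fun h => (hf i).unique hu h, fun h => h ▸ hf i⟩, ?_⟩
  have hsemi : Function.Semiconj e f (cyclicMap (Set.range u) hr) := fun i => by simp [f]
  have himg : Function.periodicPts (cyclicMap (Set.range u) hr) = e '' Function.periodicPts f := by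
    ext x
    constructor
    · rintro ⟨k, hk, hx⟩
      refine ⟨e.symm x, ⟨k, hk, e.injective ?_⟩, by simp⟩
      rw [(hsemi.iterate_right k).eq]
      simpa using hx.eq
    · rintro ⟨i, ⟨k, hk, hi⟩, rfl⟩
      refine ⟨k, hk, ?_⟩
      have := (hsemi.iterate_right k).eq i
      rw [hi] at this
      exact this.symm
  rw [numPeriodic, himg, Set.ncard_image_of_injective _ e.injective]

/-- Replacing the chosen map on a random set by a relation on fixed indices makes the count a
measurable function of the points. -/
theorem numPeriodic_range [Fintype ι] {r : ℝ} (hr : 0 < r) {u : ι → UnitAddCircle}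
    (hu : Function.Injective u) : numPeriodic (Set.range u) hr = (cycleIndices r u).card := by
  obtain ⟨f, hf, h⟩ := exists_isFurthest_iff hr hu
  rw [h, ← Set.ncard_coe_finset]
  congr 1
  ext i
  rw [Finset.mem_coe, mem_cycleIndices, transGen_iff_mem_periodicPts hf]

theorem cycleIndices_nonempty [Fintype ι] [Nonempty ι] {r : ℝ} (hr : 0 < r)
    {u : ι → UnitAddCircle} (hu : Function.Injective u) : (cycleIndices r u).Nonempty := by
  obtain ⟨f, hf, -⟩ := exists_isFurthest_iff hr hu
  obtain ⟨i⟩ := ‹Nonempty ι›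
  obtain ⟨a, b, hab, h⟩ := Finite.exists_ne_map_eq_of_infinite fun k : ℕ => f^[k] i
  wlog hlt : a < b generalizing a b
  · exact this b a hab.symm h.symm (by omega)
  refine ⟨f^[a] i, mem_cycleIndices.2 ((transGen_iff_mem_periodicPts hf _).2
    ⟨b - a, by omega, ?_⟩)⟩
  rw [Function.IsPeriodicPt, Function.IsFixedPt, ← Function.iterate_add_apply]
  rw [Nat.sub_add_cancel hlt.le]
  exact h.symm

end Relation

/-! ### Points in rotated arcs, scanned by decreasing offset -/

theorem exists_sorted_list {ι : Type*} [DecidableEq ι] (off : ι → ℝ) {K : Finset ι} (hK : Set.InjOn off K) :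
    ∃ l : List ι, l.Pairwise (fun i j => off j < off i) ∧ l.toFinset = K := by
  induction K using Finset.induction_on_min_value off with
  | empty => exact ⟨[], by simp⟩
  | insert a s ha hmin ih =>
    obtain ⟨l, hl, hls⟩ := ih (hK.mono (by simp))
    refine ⟨l ++ [a], ?_, ?_⟩
    · rw [List.pairwise_append]
      refine ⟨hl, by simp, fun x hx y hy => ?_⟩
      rw [List.mem_singleton] at hy
      subst hy
      have hx' : x ∈ s := by rw [← hls]; simpa using hx
      refine lt_of_le_of_ne (hmin x hx') fun h => ha ?_
      have := hK (by simp) (by simp [hx']) h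
      rwa [this]
    · rw [List.toFinset_append, hls]
      ext; simp

/-- Points `u i`, `i ∈ K`, with coordinates `(col i, off i)` in pairwise disjoint half-open arcs
of length `h` that start at `b j`, `j ∈ ZMod M`; the other points lie outside these arcs. -/
structure IsWindowed {M : ℕ} {ι : Type*} (b : ZMod M → UnitAddCircle) (h : ℝ)
    (u : ι → UnitAddCircle) (K : Finset ι) (col : ι → ZMod M) (off : ι → ℝ) : Prop where
  le_one : h ≤ 1
  disj : ∀ j j' (t t' : ℝ), 0 ≤ t → t < h → 0 ≤ t' → t' < h →
    b j + (t : UnitAddCircle) = b j' + (t' : UnitAddCircle) → j = j' ∧ t = t'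
  nonneg : ∀ i ∈ K, 0 ≤ off i
  lt : ∀ i ∈ K, off i < h
  eq : ∀ i ∈ K, u i = b (col i) + (off i : UnitAddCircle)
  out : ∀ i ∉ K, ∀ j (t : ℝ), 0 ≤ t → t < h → u i ≠ b j + (t : UnitAddCircle)
  inj : Set.InjOn off K

namespace IsWindowed

variable {M : ℕ} {ι : Type*} {b : ZMod M → UnitAddCircle} {h : ℝ} {u : ι → UnitAddCircle}
  {K : Finset ι} {col : ι → ZMod M} {off : ι → ℝ} {r : ℝ}

theorem coord_eq (H : IsWindowed b h u K col off) {i : ι} {j : ZMod M} {t : ℝ} (h0 : 0 ≤ t)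
    (h1 : t < h) (hi : u i = b j + (t : UnitAddCircle)) : i ∈ K ∧ col i = j ∧ off i = t := by
  have hK : i ∈ K := by
    by_contra hK
    exact H.out i hK j t h0 h1 hi
  refine ⟨hK, ?_⟩
  rw [H.eq i hK] at hi
  exact H.disj _ _ _ _ (H.nonneg i hK) (H.lt i hK) h0 h1 hi

/-- No point separates a point `y` of an arc from the end of the search range of a point `z` that
is mapped to `y`. -/
theorem gap (H : IsWindowed b h u K col off) (hr1 : r ≤ 1) {y z w : ι} (hy : y ∈ K) (hw : w ∈ K)
    (hzy : IsFurthest r u z y) (hcol : col w = col y) (hoff : off y < off w) :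
    off y + (r - cwDist (u z) (u y)) ≤ off w := by
  by_contra! hlt
  have h1 : u w = u z + ((cwDist (u z) (u y) + (off w - off y) : ℝ) : UnitAddCircle) := by
    rw [AddCircle.coe_add, ← add_assoc, add_cwDist, H.eq y hy, H.eq w hw, hcol, add_assoc,
      ← AddCircle.coe_add]
    congr 2
    ring
  have h0 := cwDist_nonneg (u z) (u y)
  have h2 : cwDist (u z) (u w) = cwDist (u z) (u y) + (off w - off y) := by
    rw [h1]
    exact cwDist_add_coe _ (by linarith) (by linarith)
  have h3 := hzy.2 w (by rw [h2]; linarith)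
  linarith

/-- Rotating `z` by `r` lands beyond `y` but, by `gap`, not beyond `w`, hence inside their common
arc. So `z` lies in the preceding arc. -/
theorem coord_of_isFurthest (H : IsWindowed b h u K col off) (hr1 : r ≤ 1) {y z w : ι}
    (hy : y ∈ K) (hw : w ∈ K) (hzy : IsFurthest r u z y) (hcol : col w = col y)
    (hoff : off y < off w) (hb : b (col y) = b (col y - 1) + (r : UnitAddCircle)) :
    z ∈ K ∧ col z = col y - 1 ∧ off z = off y + (r - cwDist (u z) (u y)) := by
  have h1 := H.gap hr1 hy hw hzy hcol hoff
  have h2 := hzy.1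
  have h3 := H.nonneg y hy
  have h4 := H.lt w hw
  refine H.coord_eq (by linarith) (by linarith) ?_
  have h5 := add_cwDist (u z) (u y)
  generalize cwDist (u z) (u y) = d at h5
  rw [← eq_sub_iff_add_eq, H.eq y hy, hb] at h5
  rw [h5, AddCircle.coe_add, AddCircle.coe_sub]
  abel

variable [Fintype ι] [DecidableEq ι]

/-- A periodic `y` that is not the first of its colour has a periodic predecessor `z` in the
preceding arc, and `gap` forbids points of the colour of `y` between `z` and `y` in the scan. -/
theorem card_le_scanCount [NeZero M] (H : IsWindowed b h u K col off) (hr1 : r ≤ 1)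
    {B : Finset (ZMod M)} (hb : ∀ j ∉ B, b j = b (j - 1) + (r : UnitAddCircle))
    {l : List ι} (hl : l.Pairwise fun i j => off j < off i) (hlK : l.toFinset = K) :
    (K ∩ cycleIndices r u).card ≤ scanCount B Finset.univ (l.map col) := by
  have hmem : ∀ i, i ∈ l ↔ i ∈ K := fun i => by rw [← hlK, List.mem_toFinset]
  have hnd : l.Nodup := hl.imp fun hij => by rintro rfl; exact lt_irrefl _ hij
  have := card_filter_le_scanCount (B := B) (cycleIndices r u) col l (Finset.subset_univ B) hnd
  rw [hlK] at this
  refine this ?_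
  intro a y b' hl' hy
  by_cases hB : col y ∈ B
  · exact Or.inl hB
  by_cases hfirst : ∀ x ∈ a, col x ≠ col y
  · exact Or.inr (Or.inl ⟨Finset.mem_univ _, hfirst⟩)
  push Not at hfirst
  obtain ⟨w, hwa, hw⟩ := hfirst
  subst hl'
  rw [List.pairwise_append] at hl
  obtain ⟨hla, hlb, hlab⟩ := hl
  have hyK : y ∈ K := (hmem y).1 (by simp)
  have hwK : w ∈ K := (hmem w).1 (by simp [hwa])
  obtain ⟨z, hz, hzy⟩ := exists_isFurthest_of_mem_cycleIndices hy
  obtain ⟨hzK, hzc, hzo⟩ := H.coord_of_isFurthest hr1 hyK hwK hzy hw (hlab w hwa y (by simp))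
    (hb _ hB)
  have hz2 := hzy.1
  have hza : z ∈ a := by
    rcases List.mem_append.1 ((hmem z).2 hzK) with h | h
    · exact h
    · rcases List.mem_cons.1 h with rfl | h
      · linarith
      · have := List.rel_of_pairwise_cons hlb h
        linarith
  obtain ⟨a₁, a₂, rfl⟩ := List.append_of_mem hza
  refine Or.inr (Or.inr ⟨a₁, z, a₂, rfl, hz, by rw [hzc]; ring, fun x hx hxc => ?_⟩)
  have h1 := H.gap hr1 hyK ((hmem x).1 (by simp [hx])) hzy hxc (hlab x (by simp [hx]) y (by simp))
  rw [List.pairwise_append] at hla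
  have h2 := List.rel_of_pairwise_cons hla.2.1 hx
  linarith

theorem exists_scanCount_le_card (hr : 0 < r) (hr1 : r ≤ 1) (hhr : h ≤ r)
    (H : IsWindowed b h u Finset.univ col off)
    (hb : ∀ j, b j = b (j - 1) + (r : UnitAddCircle))
    {l : List ι} (hl : l.Pairwise fun i j => off j < off i) (hlK : l.toFinset = Finset.univ) :
    ∃ s, scanCount ∅ {s} (l.map col) ≤ (cycleIndices r u).card := by
  have hmem : ∀ i, i ∈ l := fun i => by
    rw [← List.mem_toFinset, hlK]; exact Finset.mem_univ i
  have hnd : l.Nodup := hl.imp fun hij => by rintro rfl; exact lt_irrefl _ hij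
  have hu : Function.Injective u := fun i j hij =>
    H.inj (by simp) (by simp) (H.coord_eq (H.nonneg j (by simp)) (H.lt j (by simp))
      (hij.trans (H.eq j (by simp)))).2.2
  rcases isEmpty_or_nonempty ι with hι | hι
  · refine ⟨0, ?_⟩
    have : l = [] := List.eq_nil_iff_forall_not_mem.2 fun i => (hι.false i).elim
    simp [this, scanCount]
  -- The start is the colour of the periodic point of largest offset. It is the first of its colour,
  -- since otherwise its periodic predecessor would have a larger offset.
  obtain ⟨y, hy, hmax⟩ := (cycleIndices r u).exists_max_image off (cycleIndices_nonempty hr hu)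
  have := scanCount_singleton_le_card (cycleIndices r u) col l (col y) hnd
  rw [hlK, Finset.univ_inter] at this
  refine ⟨col y, this ?_ ?_⟩
  · rintro a y' b' rfl hc hx
    rcases List.mem_append.1 (hmem y) with h1 | h1
    · exact (hx y h1 rfl).elim
    rcases List.mem_cons.1 h1 with rfl | h1
    · exact hy
    have hlt := List.rel_of_pairwise_cons (List.pairwise_append.1 hl).2.1 h1
    obtain ⟨z, hz, hzy⟩ := exists_isFurthest_of_mem_cycleIndices hy
    have h2 := H.coord_of_isFurthest hr1 (by simp) (by simp) hzy hc hlt (hb _)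
    linarith [hmax z hz, hzy.1]
  · rintro a z b' y' c rfl hz hc hx
    refine mem_cycleIndices_of_isFurthest hu hz ?_
    have hl2 := (List.pairwise_append.1 hl).2.1
    have hlt := List.rel_of_pairwise_cons hl2 (a' := y') (by simp)
    have hb' : b (col z + 1) = b (col z) + (r : UnitAddCircle) := by
      rw [hb (col z + 1), add_sub_cancel_right]
    have h1 : u y' = u z + ((r - (off z - off y') : ℝ) : UnitAddCircle) := by
      rw [H.eq y' (by simp), H.eq z (by simp), hc, hb', AddCircle.coe_sub, AddCircle.coe_sub]
      abel
    have hz0 := H.nonneg z (by simp)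
    have hzh := H.lt z (by simp)
    have hy0 := H.nonneg y' (by simp)
    have h2 : cwDist (u z) (u y') = r - (off z - off y') := by
      rw [h1]
      exact cwDist_add_coe _ (by linarith) (by linarith)
    refine ⟨by rw [h2]; linarith, fun k hk => ?_⟩
    by_contra! hlt'
    rw [h2] at hlt'
    -- A point `k` in range beyond `y'` would have the colour of `y'` and an offset strictly between
    -- those of `y'` and `z`, so it would occur between them in the list.
    have h3 : u k = b (col z + 1) + ((off z + cwDist (u z) (u k) - r : ℝ) : UnitAddCircle) := by
      have h4 := add_cwDist (u z) (u k)
      generalize cwDist (u z) (u k) = d at h4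
      rw [← h4, hb', H.eq z (by simp), AddCircle.coe_sub, AddCircle.coe_add]
      abel
    obtain ⟨-, hkc, hko⟩ := H.coord_eq (by linarith) (by linarith) h3
    rcases List.mem_append.1 (hmem k) with h4 | h4
    · have := (List.pairwise_append.1 hl).2.2 k h4 z (by simp)
      linarith
    rcases List.mem_cons.1 h4 with rfl | h4
    · linarith
    rcases List.mem_append.1 h4 with h4 | h4
    · exact hx k h4 (by rw [hkc, hc])
    have hl3 := (List.pairwise_append.1 (List.pairwise_cons.1 hl2).2).2.1
    rcases List.mem_cons.1 h4 with rfl | h4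
    · linarith
    · linarith [List.rel_of_pairwise_cons hl3 h4]

/-- Expected-count bound over all recolourings of the points. -/
theorem sum_card_le [NeZero M] (hr1 : r ≤ 1) {B : Finset (ZMod M)}
    (hb : ∀ j ∉ B, b j = b (j - 1) + (r : UnitAddCircle)) {D : ℕ} (hD : 1 ≤ D) (hDM : D ≤ M)
    {v : (ι → ZMod M) → ι → UnitAddCircle}
    (H : ∀ c, IsWindowed b h (v c) K (col + c) off) :
    D * ∑ c, ((K ∩ cycleIndices r (v c)).card : ℝ)
      ≤ M ^ Fintype.card ι * (K.card * (1 + D ^ 3 * B.card / M) + D * D * M) := by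
  obtain ⟨l, hl, hlK⟩ := exists_sorted_list off (H 0).inj
  have hnd : l.Nodup := hl.imp fun hij => by rintro rfl; exact lt_irrefl _ hij
  have hlen : l.length = K.card := by rw [← hlK, List.toFinset_card_of_nodup hnd]
  have h1 := sum_scanCount_le B hD hDM l hnd (Finset.subset_univ B)
  have h2 : ∑ c, ((K ∩ cycleIndices r (v c)).card : ℝ)
      ≤ ∑ c : ι → ZMod M, (scanCount B Finset.univ (l.map c) : ℝ) := by
    -- Shifting by the original colours turns recolourings into arbitrary words.
    have e : ∑ c : ι → ZMod M, (scanCount B Finset.univ (l.map (col + c)) : ℝ)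
        = ∑ c : ι → ZMod M, (scanCount B Finset.univ (l.map c) : ℝ) :=
      Fintype.sum_equiv (Equiv.addLeft col) _ _ fun c => rfl
    rw [← e]
    exact Finset.sum_le_sum fun c _ => by exact_mod_cast (H c).card_le_scanCount hr1 hb hl hlK
  have h3 := scanPotential_le D (Finset.univ : Finset (ZMod M))
  rw [hlen] at h1
  calc _ ≤ D * ∑ c : ι → ZMod M, (scanCount B Finset.univ (l.map c) : ℝ) := by gcongr
    _ ≤ _ := h1
    _ ≤ _ := by gcongr

/-- The good start `s` depends on the colouring. Summing over all starts and bounding the other `M -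
1` counts by the full system leaves a mean of at least `n - (M - 1) * (n / M + M ^ 2)`, for `n`
points and up to the factor `M ^ n`; this exceeds `n / M - M ^ 3`. -/
theorem le_sum_card [NeZero M] (hr : 0 < r) (hr1 : r ≤ 1) (hhr : h ≤ r)
    (hb : ∀ j, b j = b (j - 1) + (r : UnitAddCircle))
    {v : (ι → ZMod M) → ι → UnitAddCircle}
    (H : ∀ c, IsWindowed b h (v c) Finset.univ (col + c) off) :
    (M : ℝ) ^ Fintype.card ι * (Fintype.card ι / M - M ^ 3)
      ≤ ∑ c, ((cycleIndices r (v c)).card : ℝ) := by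
  have hM : (0 : ℝ) < M := by exact_mod_cast (NeZero.pos M)
  obtain ⟨l, hl, hlK⟩ := exists_sorted_list off (H 0).inj
  have hnd : l.Nodup := hl.imp fun hij => by rintro rfl; exact lt_irrefl _ hij
  have hlen : l.length = Fintype.card ι := by
    rw [← List.toFinset_card_of_nodup hnd, hlK, Finset.card_univ]
  have h1 := sum_scanCount_le ∅ (NeZero.pos M) le_rfl l hnd (Finset.empty_subset Finset.univ)
  have h3 := scanPotential_le M (Finset.univ : Finset (ZMod M))
  have h4 : ∀ s : ZMod M, M * ∑ c : ι → ZMod M, (scanCount ∅ {s} (l.map c) : ℝ)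
      = M ^ Fintype.card ι * l.length := fun s => sum_scanCount_of_card_eq_one l hnd (by simp)
  have h5 : ∀ c : ι → ZMod M, ∑ s : ZMod M, (scanCount ∅ {s} (l.map (col + c)) : ℝ)
      - (M - 1) * (scanCount ∅ Finset.univ (l.map (col + c)) : ℝ)
      ≤ ((cycleIndices r (v c)).card : ℝ) := by
    intro c
    obtain ⟨s, hs⟩ := (H c).exists_scanCount_le_card hr hr1 hhr hb hl hlK
    have hs' : (scanCount ∅ {s} (l.map (col + c)) : ℝ) ≤ (cycleIndices r (v c)).card := by
      exact_mod_cast hs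
    rw [← Finset.add_sum_erase _ _ (Finset.mem_univ s)]
    have : ∑ s' ∈ Finset.univ.erase s, (scanCount ∅ {s'} (l.map (col + c)) : ℝ)
        ≤ ∑ s' ∈ Finset.univ.erase s, (scanCount ∅ Finset.univ (l.map (col + c)) : ℝ) :=
      Finset.sum_le_sum fun s' _ => by
        exact_mod_cast scanCount_mono _ (Finset.empty_subset _) (Finset.subset_univ _)
    rw [Finset.sum_const, Finset.card_erase_of_mem (Finset.mem_univ s), Finset.card_univ,
      ZMod.card, nsmul_eq_mul, Nat.cast_sub (NeZero.pos M), Nat.cast_one] at this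
    linarith
  have h6 := Finset.sum_le_sum fun c (_ : c ∈ Finset.univ) => h5 c
  rw [Finset.sum_sub_distrib, Finset.sum_comm, ← Finset.mul_sum] at h6
  have h7 : ∀ S : Finset (ZMod M), ∑ c : ι → ZMod M, (scanCount ∅ S (l.map (col + c)) : ℝ)
      = ∑ c : ι → ZMod M, (scanCount ∅ S (l.map c) : ℝ) := fun S =>
    Fintype.sum_equiv (Equiv.addLeft col) _ _ fun c => rfl
  have h8 : ∀ s : ZMod M, ∑ c : ι → ZMod M, (scanCount ∅ {s} (l.map (col + c)) : ℝ)
      = M ^ Fintype.card ι * l.length / M := fun s => by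
    rw [h7, eq_div_iff hM.ne', mul_comm, h4]
  rw [Finset.sum_congr rfl fun s _ => h8 s, h7] at h6
  simp only [Finset.sum_const, Finset.card_univ, ZMod.card, nsmul_eq_mul, hlen] at h6
  rw [hlen] at h1
  simp only [Finset.card_empty, Nat.cast_zero, mul_zero, zero_div, add_zero, mul_one] at h1
  refine le_trans ?_ h6
  set X := ∑ c : ι → ZMod M, (scanCount ∅ Finset.univ (l.map c) : ℝ)
  set p := (M : ℝ) ^ Fintype.card ι
  have hp : 0 < p := by positivity
  have h9 : X ≤ p * (Fintype.card ι / M + M ^ 2) := by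
    refine le_of_mul_le_mul_left ?_ hM
    refine h1.trans ?_
    have : (M : ℝ) * (p * (Fintype.card ι / M + M ^ 2)) = p * (Fintype.card ι + M * M * M) := by
      field_simp
    rw [this]
    gcongr
  have hM1 : (0 : ℝ) ≤ M - 1 := by
    have : (1 : ℝ) ≤ M := by exact_mod_cast (NeZero.pos M)
    linarith
  have h10 := mul_le_mul_of_nonneg_left h9 hM1
  have e : (M : ℝ) * (p * Fintype.card ι / M) - (M - 1) * (p * (Fintype.card ι / M + M ^ 2))
      = p * (Fintype.card ι / M - M ^ 3) + p * M ^ 2 := by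
    field_simp
    ring
  have : 0 ≤ p * (M : ℝ) ^ 2 := by positivity
  linarith

end IsWindowed

/-! ### Recolouring preserves the uniform measure -/

instance : IsProbabilityMeasure (volume : Measure UnitAddCircle) :=
  ⟨UnitAddCircle.measure_univ⟩

theorem volume_unitAddCircle_singleton (x : UnitAddCircle) : volume {x} = 0 := by
  rw [← Metric.closedBall_zero, AddCircle.volume_closedBall]
  simp

theorem cwDist_eq_of_sub_eq {x y x' y' : UnitAddCircle} (h : y - x = y' - x') :
    cwDist x y = cwDist x' y' := by
  rw [cwDist, cwDist, h]

/-- The piecewise translation that moves the arc of length `h` at `b j` to the one at `b (j + c)`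
and fixes all points outside these arcs. -/
noncomputable def recolor {M : ℕ} [NeZero M] (b : ZMod M → UnitAddCircle) (h : ℝ) (c : ZMod M)
    (x : UnitAddCircle) : UnitAddCircle :=
  x + ∑ j, {x | cwDist (b j) x < h}.indicator (fun _ => b (j + c) - b j) x

/-- The arcs of length `h` that start at the points `b j` are pairwise disjoint. -/
structure DisjointArcs {M : ℕ} (b : ZMod M → UnitAddCircle) (h : ℝ) : Prop where
  le_one : h ≤ 1
  disj : ∀ j j' (t t' : ℝ), 0 ≤ t → t < h → 0 ≤ t' → t' < h →
    b j + (t : UnitAddCircle) = b j' + (t' : UnitAddCircle) → j = j' ∧ t = t'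

namespace DisjointArcs

variable {M : ℕ} {b : ZMod M → UnitAddCircle} {h : ℝ}

theorem eq_of_cwDist_lt (H : DisjointArcs b h) {j j' : ZMod M} {x : UnitAddCircle}
    (hj : cwDist (b j) x < h) (hj' : cwDist (b j') x < h) : j = j' :=
  (H.disj j j' _ _ (cwDist_nonneg _ _) hj (cwDist_nonneg _ _) hj'
    (by rw [add_cwDist, add_cwDist])).1

variable [NeZero M]

theorem recolor_of_lt (H : DisjointArcs b h) (c : ZMod M) {j : ZMod M} {x : UnitAddCircle}
    (hj : cwDist (b j) x < h) : recolor b h c x = x + (b (j + c) - b j) := by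
  rw [recolor, Finset.sum_eq_single j]
  · exact congrArg (x + ·) (Set.indicator_of_mem (s := {x | cwDist (b j) x < h}) hj _)
  · intro j' _ hne
    exact Set.indicator_of_notMem (s := {x | cwDist (b j') x < h})
      (fun hj' => hne (H.eq_of_cwDist_lt hj' hj)) _
  · simp

theorem recolor_of_not_lt (c : ZMod M) {x : UnitAddCircle} (hx : ∀ j, ¬ cwDist (b j) x < h) :
    recolor b h c x = x := by
  rw [recolor, Finset.sum_eq_zero, add_zero]
  intro j _
  exact Set.indicator_of_notMem (s := {x | cwDist (b j) x < h}) (hx j) _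

theorem measurableSet_arc (x : UnitAddCircle) (h : ℝ) : MeasurableSet {y | cwDist x y < h} :=
  measurableSet_lt (measurable_cwDist_right x) measurable_const

theorem measurable_recolor (c : ZMod M) : Measurable (recolor b h c) := by
  unfold recolor
  refine measurable_id.add (Finset.measurable_sum _ fun j _ => ?_)
  exact measurable_const.indicator (measurableSet_arc _ _)

/-- The map permutes disjoint arcs by translations and is the identity elsewhere, so measures can be
compared piece by piece. -/
theorem measurePreserving_recolor (H : DisjointArcs b h) (c : ZMod M) :
    MeasurePreserving (recolor b h c) volume volume := by
  refine ⟨measurable_recolor c, ?_⟩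
  ext A hA
  rw [Measure.map_apply (measurable_recolor c) hA]
  set W : ZMod M → Set UnitAddCircle := fun j => {x | cwDist (b j) x < h}
  have hW : ∀ j, MeasurableSet (W j) := fun j => measurableSet_arc _ _
  have hdisj : Pairwise (Function.onFun Disjoint W) := by
    intro j j' hne
    refine Set.disjoint_left.2 fun x hx hx' => hne (H.eq_of_cwDist_lt hx hx')
  have split : ∀ E : Set UnitAddCircle, MeasurableSet E →
      volume E = ∑ j, volume (E ∩ W j) + volume (E \ ⋃ j, W j) := by
    intro E hE
    rw [← measure_inter_add_sdiff E (MeasurableSet.iUnion hW), Set.inter_iUnion, measure_iUnion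
      (fun j j' hne => (hdisj hne).mono Set.inter_subset_right Set.inter_subset_right)
      (fun j => hE.inter (hW j)), tsum_fintype]
  rw [split _ (measurable_recolor c hA), split A hA]
  congr 1
  · refine Fintype.sum_equiv (Equiv.addRight c) _ _ fun j => ?_
    rw [Equiv.coe_addRight, ← measure_preimage_add_right volume (b (j + c) - b j) (A ∩ W (j + c))]
    congr 1
    ext x
    have h1 : cwDist (b (j + c)) (x + (b (j + c) - b j)) = cwDist (b j) x :=
      cwDist_eq_of_sub_eq (by abel)
    simp only [Set.mem_inter_iff, Set.mem_preimage, W, Set.mem_ofPred_eq, h1]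
    refine and_congr_left fun hx => ?_
    rw [H.recolor_of_lt c hx]
  · congr 1
    ext x
    simp only [Set.mem_sdiff, Set.mem_preimage, Set.mem_iUnion, not_exists]
    refine and_congr_left fun hx => ?_
    rw [recolor_of_not_lt c hx]

open Classical in
/-- The indices of the points that lie in one of the arcs. -/
noncomputable def _root_.arcIndices {ι : Type*} [Fintype ι] (b : ZMod M → UnitAddCircle) (h : ℝ)
    (u : ι → UnitAddCircle) : Finset ι :=
  Finset.univ.filter fun i => ∃ j, cwDist (b j) (u i) < h

variable {ι : Type*} [Fintype ι]

theorem _root_.mem_arcIndices {u : ι → UnitAddCircle} {i : ι} :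
    i ∈ arcIndices b h u ↔ ∃ j, cwDist (b j) (u i) < h := by
  simp [arcIndices]

theorem cwDist_recolor (H : DisjointArcs b h) (c : ZMod M) {j : ZMod M} {x : UnitAddCircle}
    (hj : cwDist (b j) x < h) : cwDist (b (j + c)) (recolor b h c x) = cwDist (b j) x := by
  rw [H.recolor_of_lt c hj]
  exact cwDist_eq_of_sub_eq (by abel)

theorem arcIndices_recolor (H : DisjointArcs b h) (c : ι → ZMod M) (u : ι → UnitAddCircle) :
    arcIndices b h (fun i => recolor b h (c i) (u i)) = arcIndices b h u := by
  ext i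
  rw [mem_arcIndices, mem_arcIndices]
  constructor
  · rintro ⟨j, hj⟩
    by_contra! hx
    rw [recolor_of_not_lt (c i) fun j => (hx j).not_gt] at hj
    exact absurd hj (hx j).not_gt
  · rintro ⟨j, hj⟩
    exact ⟨j + c i, by rwa [H.cwDist_recolor _ hj]⟩

/-- Recolouring adds `c` to the colours and keeps the offsets, so one pair `col`, `off` serves every
`c`. Equal offsets would make two points differ by some `b j - b j'`, which the hypothesis excludes.
-/
theorem exists_isWindowed (H : DisjointArcs b h) {u : ι → UnitAddCircle}
    (hu : ∀ i k, i ≠ k → ∀ j j', u i ≠ u k + (b j - b j')) :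
    ∃ (col : ι → ZMod M) (off : ι → ℝ), ∀ c : ι → ZMod M,
      IsWindowed b h (fun i => recolor b h (c i) (u i)) (arcIndices b h u) (col + c) off := by
  have : ∀ i, ∃ j, i ∈ arcIndices b h u → cwDist (b j) (u i) < h := by
    intro i
    by_cases hi : i ∈ arcIndices b h u
    · obtain ⟨j, hj⟩ := mem_arcIndices.1 hi
      exact ⟨j, fun _ => hj⟩
    · exact ⟨0, fun h => (hi h).elim⟩
  choose col hcol using this
  refine ⟨col, fun i => cwDist (b (col i)) (u i), fun c => ⟨H.le_one, H.disj,
    fun i _ => cwDist_nonneg _ _, fun i hi => hcol i hi, fun i hi => ?_, fun i hi j t h0 h1 h2 => ?_,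
    fun i hi k hk hik => ?_⟩⟩
  · rw [Pi.add_apply, ← H.cwDist_recolor (c i) (hcol i hi), add_cwDist]
  · rw [← H.arcIndices_recolor c u] at hi
    refine hi (mem_arcIndices.2 ⟨j, ?_⟩)
    rw [h2, cwDist_add_coe _ h0 (h1.trans_le H.le_one)]
    exact h1
  · by_contra hne
    refine hu i k hne (col i) (col k) ?_
    have h1 := add_cwDist (b (col i)) (u i)
    have h2 := add_cwDist (b (col k)) (u k)
    rw [hik] at h1
    generalize cwDist (b (col k)) (u k) = d at h1 h2
    rw [← h1, ← h2]
    abel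

end DisjointArcs

/-! ### Measurability and almost sure genericity -/

section Measurability

variable {ι : Type*} [Fintype ι]

theorem measurableSet_mem_cycleIndices (r : ℝ) (i : ι) :
    MeasurableSet {u : ι → UnitAddCircle | i ∈ cycleIndices r u} := by
  have h1 : ∀ i j, MeasurableSet {u : ι → UnitAddCircle | IsFurthest r u i j} := by
    intro i j
    have hd : ∀ k, Measurable fun u : ι → UnitAddCircle => cwDist (u i) (u k) := fun k =>
      (measurable_pi_apply i).cwDist (measurable_pi_apply k)
    have e : {u : ι → UnitAddCircle | IsFurthest r u i j} = {u | cwDist (u i) (u j) < r} ∩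
        ⋂ k, ({u | cwDist (u i) (u k) < r}ᶜ ∪ {u | cwDist (u i) (u k) ≤ cwDist (u i) (u j)}) := by
      ext u
      simp only [IsFurthest, Set.mem_ofPred_eq, Set.mem_inter_iff, Set.mem_iInter, Set.mem_union,
        Set.mem_compl_iff, imp_iff_not_or]
    rw [e]
    exact (measurableSet_lt (hd j) measurable_const).inter (MeasurableSet.iInter fun k =>
      (measurableSet_lt (hd k) measurable_const).compl.union (measurableSet_le (hd k) (hd j)))
  have h2 : Measurable fun (u : ι → UnitAddCircle) (p : ι × ι) => IsFurthest r u p.1 p.2 :=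
    measurable_pi_iff.2 fun p => measurableSet_setOfPred.1 (h1 p.1 p.2)
  have h3 : {u : ι → UnitAddCircle | i ∈ cycleIndices r u}
      = (fun (u : ι → UnitAddCircle) (p : ι × ι) => IsFurthest r u p.1 p.2) ⁻¹'
        {T | Relation.TransGen (fun i j => T (i, j)) i i} := by
    ext u
    simp [mem_cycleIndices]
  rw [h3]
  -- There are only finitely many relations on `ι`, so every set of them is measurable.
  exact h2 (Set.toFinite _).measurableSet

theorem measurable_card_of_measurableSet_mem {α : Type*} [MeasurableSpace α] {s : α → Finset ι}
    (hs : ∀ i, MeasurableSet {a | i ∈ s a}) : Measurable fun a => ((s a).card : ℝ) := by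
  classical
  have : (fun a => ((s a).card : ℝ)) = fun a => ∑ i, {a | i ∈ s a}.indicator (fun _ => (1 : ℝ)) a := by
    ext a
    simp [Set.indicator_apply]
  rw [this]
  exact Finset.measurable_sum _ fun i _ => measurable_const.indicator (hs i)

theorem integrable_card_of_measurableSet_mem {α : Type*} [MeasurableSpace α] {μ : Measure α}
    [IsFiniteMeasure μ] {s : α → Finset ι}
    (hs : ∀ i, MeasurableSet {a | i ∈ s a}) : Integrable (fun a => ((s a).card : ℝ)) μ := by
  refine Integrable.of_bound (measurable_card_of_measurableSet_mem hs).aestronglyMeasurable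
    (Fintype.card ι : ℝ) (Eventually.of_forall fun a => ?_)
  rw [Real.norm_of_nonneg (by positivity)]
  exact_mod_cast (s a).card_le_univ

theorem measurableSet_mem_arcIndices {M : ℕ} [NeZero M] (b : ZMod M → UnitAddCircle) (h : ℝ)
    (i : ι) : MeasurableSet {u : ι → UnitAddCircle | i ∈ arcIndices b h u} := by
  have : {u : ι → UnitAddCircle | i ∈ arcIndices b h u} = ⋃ j, {u | cwDist (b j) (u i) < h} := by
    ext u
    simp [mem_arcIndices]
  rw [this]
  exact MeasurableSet.iUnion fun j =>
    (DisjointArcs.measurableSet_arc (b j) h).preimage (measurable_pi_apply i)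

theorem ae_apply_ne_apply_add {i k : ι} (hik : i ≠ k) (g : UnitAddCircle) :
    ∀ᵐ u : ι → UnitAddCircle ∂(Measure.pi fun _ => volume), u i ≠ u k + g := by
  have hind : iIndepFun (fun (i : ι) (u : ι → UnitAddCircle) => u i)
      (Measure.pi fun _ => (volume : Measure UnitAddCircle)) :=
    iIndepFun_pi (X := fun _ => id) fun i => aemeasurable_id
  have h2 := (indepFun_iff_map_prod_eq_prod_map_map (measurable_pi_apply i).aemeasurable
    (measurable_pi_apply k).aemeasurable).1 (hind.indepFun hik)
  have hmap : ∀ i, (Measure.pi fun _ : ι => (volume : Measure UnitAddCircle)).map (fun u => u i)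
      = volume := fun i => (measurePreserving_eval _ i).map_eq
  rw [hmap, hmap] at h2
  have hA : MeasurableSet {p : UnitAddCircle × UnitAddCircle | p.1 = p.2 + g} :=
    measurableSet_eq_fun measurable_fst (measurable_snd.add_const g)
  have h3 : (volume.prod volume) {p : UnitAddCircle × UnitAddCircle | p.1 = p.2 + g} = 0 := by
    rw [Measure.measure_prod_null hA]
    refine Eventually.of_forall fun x => ?_
    have : Prod.mk x ⁻¹' {p : UnitAddCircle × UnitAddCircle | p.1 = p.2 + g} = {x - g} := by
      ext y
      simp [eq_comm, eq_sub_iff_add_eq]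
    exact (congrArg volume this).trans (volume_unitAddCircle_singleton _)
  rw [← h2, Measure.map_apply ((measurable_pi_apply i).prodMk (measurable_pi_apply k)) hA] at h3
  rw [ae_iff]
  simpa using h3

theorem ae_generic {M : ℕ} [NeZero M] (b : ZMod M → UnitAddCircle) :
    ∀ᵐ u : ι → UnitAddCircle ∂(Measure.pi fun _ => volume),
      ∀ i k, i ≠ k → ∀ j j', u i ≠ u k + (b j - b j') := by
  simp only [eventually_all]
  exact fun i k hik j j' => ae_apply_ne_apply_add hik _

theorem ae_injective :
    ∀ᵐ u : ι → UnitAddCircle ∂(Measure.pi fun _ => volume), Function.Injective u := by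
  have : ∀ᵐ u : ι → UnitAddCircle ∂(Measure.pi fun _ => volume), ∀ i k, i ≠ k → u i ≠ u k + 0 := by
    simp only [eventually_all]
    exact fun i k hik => ae_apply_ne_apply_add hik _
  filter_upwards [this] with u hu i k hik
  by_contra hne
  exact hu i k hne (by rw [add_zero, hik])

end Measurability

/-! ### Expectation bounds for a family of arcs -/

namespace DisjointArcs

variable {M : ℕ} [NeZero M] {b : ZMod M → UnitAddCircle} {h r : ℝ}
  {ι : Type*} [Fintype ι] [DecidableEq ι]

/-- Integrals may be averaged over all recolourings, so bounds for fixed offsets and uniform colours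
pass to uniform points. -/
theorem integral_recolor (H : DisjointArcs b h) {F : (ι → UnitAddCircle) → ℝ}
    (hF : Measurable F) (hFi : Integrable F (Measure.pi fun _ => volume)) :
    (M : ℝ) ^ Fintype.card ι * ∫ u, F u ∂(Measure.pi fun _ => volume)
      = ∫ u, ∑ c : ι → ZMod M, F (fun i => recolor b h (c i) (u i))
          ∂(Measure.pi fun _ => volume) ∧
    Integrable (fun u => ∑ c : ι → ZMod M, F (fun i => recolor b h (c i) (u i)))
      (Measure.pi fun _ => volume) := by
  have hmp : ∀ c : ι → ZMod M, MeasurePreserving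
      (fun (u : ι → UnitAddCircle) i => recolor b h (c i) (u i))
      (Measure.pi fun _ => volume) (Measure.pi fun _ => volume) := fun c =>
    measurePreserving_pi _ _ fun i => H.measurePreserving_recolor (c i)
  have hint : ∀ c : ι → ZMod M, Integrable (fun u => F (fun i => recolor b h (c i) (u i)))
      (Measure.pi fun _ => volume) := fun c => (hmp c).integrable_comp_of_integrable hFi
  refine ⟨?_, integrable_finsetSum _ fun c _ => hint c⟩
  rw [integral_finsetSum _ fun c _ => hint c]
  have : ∀ c : ι → ZMod M, ∫ u, F (fun i => recolor b h (c i) (u i)) ∂(Measure.pi fun _ => volume)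
      = ∫ u, F u ∂(Measure.pi fun _ => volume) := by
    intro c
    conv_rhs => rw [← (hmp c).map_eq]
    rw [integral_map (hmp c).measurable.aemeasurable hF.aestronglyMeasurable]
  rw [Finset.sum_congr rfl fun c _ => this c]
  simp [ZMod.card]

theorem measurableSet_mem_inter (b : ZMod M → UnitAddCircle) (h r : ℝ) (i : ι) :
    MeasurableSet {u : ι → UnitAddCircle | i ∈ arcIndices b h u ∩ cycleIndices r u} := by
  simp only [Finset.mem_inter]
  exact (measurableSet_mem_arcIndices b h i).inter (measurableSet_mem_cycleIndices r i)

theorem integral_card_le (H : DisjointArcs b h) (hr1 : r ≤ 1) {B : Finset (ZMod M)}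
    (hb : ∀ j ∉ B, b j = b (j - 1) + (r : UnitAddCircle)) {D : ℕ} (hD : 1 ≤ D) (hDM : D ≤ M) :
    D * ∫ u : ι → UnitAddCircle, ((arcIndices b h u ∩ cycleIndices r u).card : ℝ)
        ∂(Measure.pi fun _ => volume)
      ≤ (∫ u : ι → UnitAddCircle, ((arcIndices b h u).card : ℝ) ∂(Measure.pi fun _ => volume))
        * (1 + D ^ 3 * B.card / M) + D * D * M := by
  have hM : (0 : ℝ) < M := by exact_mod_cast (NeZero.pos M)
  obtain ⟨h1, h2⟩ := H.integral_recolor (ι := ι)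
    (measurable_card_of_measurableSet_mem (measurableSet_mem_inter b h r))
    (integrable_card_of_measurableSet_mem (measurableSet_mem_inter b h r))
  have hK : Integrable (fun u : ι → UnitAddCircle => ((arcIndices b h u).card : ℝ))
      (Measure.pi fun _ => volume) :=
    integrable_card_of_measurableSet_mem (measurableSet_mem_arcIndices b h)
  have hKint : Integrable (fun u : ι → UnitAddCircle => (M : ℝ) ^ Fintype.card ι *
      ((arcIndices b h u).card * (1 + D ^ 3 * B.card / M) + D * D * M))
      (Measure.pi fun _ => volume) :=
    ((hK.mul_const _).add (integrable_const _)).const_mul _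
  have h3 := integral_mono_ae (h2.const_mul (D : ℝ)) hKint (by
    filter_upwards [ae_generic (ι := ι) b] with u hu
    obtain ⟨col, off, hw⟩ := H.exists_isWindowed hu
    simp only [H.arcIndices_recolor]
    exact IsWindowed.sum_card_le hr1 hb hD hDM hw)
  rw [integral_const_mul, ← h1, integral_const_mul, integral_add (hK.mul_const _)
    (integrable_const _), integral_mul_const] at h3
  simp only [integral_const, probReal_univ, smul_eq_mul, one_mul] at h3
  refine le_of_mul_le_mul_left ?_ (pow_pos hM (Fintype.card ι))
  rw [mul_left_comm]
  exact h3

theorem le_integral_card (H : DisjointArcs b h) (hr : 0 < r) (hr1 : r ≤ 1) (hhr : h ≤ r)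
    (hb : ∀ j, b j = b (j - 1) + (r : UnitAddCircle))
    (hcover : ∀ x, ∃ j, cwDist (b j) x < h) :
    (Fintype.card ι : ℝ) / M - M ^ 3 ≤ ∫ u : ι → UnitAddCircle, ((cycleIndices r u).card : ℝ)
        ∂(Measure.pi fun _ => volume) := by
  have hM : (0 : ℝ) < M := by exact_mod_cast (NeZero.pos M)
  obtain ⟨h1, h2⟩ := H.integral_recolor (ι := ι)
    (measurable_card_of_measurableSet_mem (measurableSet_mem_cycleIndices r))
    (integrable_card_of_measurableSet_mem (measurableSet_mem_cycleIndices r))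
  have h3 := integral_mono_ae (integrable_const
    ((M : ℝ) ^ Fintype.card ι * (Fintype.card ι / M - M ^ 3))) h2 (by
    filter_upwards [ae_generic (ι := ι) b] with u hu
    obtain ⟨col, off, hw⟩ := H.exists_isWindowed hu
    have hK : arcIndices b h u = Finset.univ :=
      Finset.eq_univ_iff_forall.2 fun i => mem_arcIndices.2 (hcover (u i))
    rw [hK] at hw
    exact IsWindowed.le_sum_card hr hr1 hhr hb hw)
  rw [← h1] at h3
  simp only [integral_const, probReal_univ, smul_eq_mul, one_mul] at h3
  exact le_of_mul_le_mul_left h3 (pow_pos hM (Fintype.card ι))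

end DisjointArcs

/-! ### Arcs along an orbit of the rotation -/

theorem UnitAddCircle.coe_eq_coe_iff {x y : ℝ} :
    (x : UnitAddCircle) = y ↔ ∃ k : ℤ, x - y = k := by
  rw [← sub_eq_zero, ← AddCircle.coe_sub, AddCircle.coe_eq_zero_iff]
  simp [eq_comm]

/-- The points `θ, θ + r, …, θ + (M - 1) r`. -/
noncomputable def rotationPoint (M : ℕ) (θ : UnitAddCircle) (r : ℝ) (j : ZMod M) : UnitAddCircle :=
  θ + ((j.val * r : ℝ) : UnitAddCircle)

section Arcs

theorem rotationPoint_add_eq_iff {M : ℕ} {θ : UnitAddCircle} {r : ℝ} {j j' : ZMod M} {t t' : ℝ} :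
    rotationPoint M θ r j + (t : UnitAddCircle) = rotationPoint M θ r j' + (t' : UnitAddCircle) ↔
      ∃ k : ℤ, (j.val : ℝ) * r + t - (j'.val * r + t') = k := by
  rw [rotationPoint, rotationPoint, add_assoc, add_assoc, add_right_inj, ← AddCircle.coe_add,
    ← AddCircle.coe_add, UnitAddCircle.coe_eq_coe_iff]

variable {M : ℕ} [NeZero M] {θ : UnitAddCircle} {r : ℝ}

theorem ZMod.val_sub_one_add_one {j : ZMod M} (hj : j ≠ 0) : (j - 1).val + 1 = j.val := by
  have h0 : 0 < j.val := Nat.pos_of_ne_zero fun h => hj ((ZMod.val_eq_zero j).1 h)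
  have h1 : j - 1 = ((j.val - 1 : ℕ) : ZMod M) := by
    rw [Nat.cast_sub h0, ZMod.natCast_zmod_val, Nat.cast_one]
  have h2 := j.val_lt
  rw [h1, ZMod.val_natCast_of_lt (by omega)]
  omega

theorem rotationPoint_eq_of_ne_zero {j : ZMod M} (hj : j ≠ 0) :
    rotationPoint M θ r j = rotationPoint M θ r (j - 1) + (r : UnitAddCircle) := by
  rw [rotationPoint, rotationPoint, add_assoc, ← AddCircle.coe_add, ← ZMod.val_sub_one_add_one hj]
  congr 2
  push_cast
  ring

theorem rotationPoint_rat_eq {p q : ℕ} [NeZero q] (j : ZMod q) :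
    rotationPoint q θ ((p : ℝ) / q) j
      = rotationPoint q θ ((p : ℝ) / q) (j - 1) + (((p : ℝ) / q : ℝ) : UnitAddCircle) := by
  by_cases hj : j = 0
  · subst hj
    have hq : (q : ℝ) ≠ 0 := by exact_mod_cast NeZero.ne q
    have h0 : ((0 : ZMod q) - 1).val + 1 = q := by
      obtain ⟨q, rfl⟩ : ∃ m, q = m + 1 := ⟨q - 1, by have := NeZero.pos q; omega⟩
      rw [zero_sub, ZMod.val_neg_one]
    rw [rotationPoint, rotationPoint, add_assoc, ← AddCircle.coe_add]
    congr 1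
    rw [UnitAddCircle.coe_eq_coe_iff]
    refine ⟨-p, ?_⟩
    have h1 : ((((0 : ZMod q) - 1).val : ℝ)) + 1 = q := by exact_mod_cast h0
    have h2 : ((((0 : ZMod q) - 1).val : ℝ)) = q - 1 := by linarith
    rw [h2, ZMod.val_zero]
    push_cast
    field_simp
    ring
  · exact rotationPoint_eq_of_ne_zero hj

theorem disjointArcs_rotationPoint_rat {p q : ℕ} [NeZero q] (hpq : p.Coprime q) :
    DisjointArcs (rotationPoint q θ ((p : ℝ) / q)) (1 / (q : ℝ)) := by
  have hq : (0 : ℝ) < q := by exact_mod_cast NeZero.pos q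
  have hq1 : (1 : ℝ) ≤ q := by exact_mod_cast NeZero.pos q
  refine ⟨(div_le_one hq).2 hq1, fun j j' t t' h0 h1 h0' h1' h => ?_⟩
  obtain ⟨k, hk⟩ := rotationPoint_add_eq_iff.1 h
  rw [lt_div_iff₀ hq] at h1 h1'
  have e : (q : ℝ) * (t - t') = ((k * q - (j.val - j'.val) * p : ℤ) : ℝ) := by
    push_cast
    rw [← hk]
    field_simp
    ring
  -- This integer equals `q * (t - t')`, which lies strictly between `-1` and `1`.
  have hz : (k * q - (j.val - j'.val) * p : ℤ) = 0 := by
    have h2 : ((k * q - (j.val - j'.val) * p : ℤ) : ℝ) < 1 := by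
      rw [← e]; nlinarith
    have h3 : (-1 : ℝ) < ((k * q - (j.val - j'.val) * p : ℤ) : ℝ) := by
      rw [← e]; nlinarith
    have h2' : (k * q - (j.val - j'.val) * p : ℤ) < 1 := by exact_mod_cast h2
    have h3' : (-1 : ℤ) < (k * q - (j.val - j'.val) * p : ℤ) := by exact_mod_cast h3
    omega
  constructor
  · have h4 := congrArg (fun z : ℤ => (z : ZMod q)) hz
    simp only [Int.cast_sub, Int.cast_mul, Int.cast_natCast, ZMod.natCast_self, mul_zero, zero_sub,
      ZMod.natCast_zmod_val, Int.cast_zero, neg_eq_zero] at h4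
    have hu : IsUnit (p : ZMod q) := (ZMod.isUnit_iff_coprime p q).2 hpq
    exact sub_eq_zero.1 (hu.mul_left_eq_zero.1 h4)
  · rw [hz, Int.cast_zero, mul_eq_zero] at e
    rcases e with e | e
    · exact absurd e hq.ne'
    · linarith

theorem exists_rotationPoint_rat_cwDist_lt {p q : ℕ} [NeZero q] (hpq : p.Coprime q)
    (x : UnitAddCircle) : ∃ j, cwDist (rotationPoint q θ ((p : ℝ) / q) j) x < 1 / (q : ℝ) := by
  have hq : (0 : ℝ) < q := by exact_mod_cast NeZero.pos q
  have hq1 : (1 : ℝ) ≤ q := by exact_mod_cast NeZero.pos q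
  have hu : IsUnit (p : ZMod q) := (ZMod.isUnit_iff_coprime p q).2 hpq
  set y := cwDist θ x
  set i := ⌊q * y⌋
  obtain ⟨j, hj⟩ : ∃ j : ZMod q, j * p = i := by
    obtain ⟨v, hv⟩ := hu
    exact ⟨i * (v⁻¹ : (ZMod q)ˣ), by rw [← hv, mul_assoc, Units.inv_mul, mul_one]⟩
  have h1 : ((j.val * p - i : ℤ) : ZMod q) = 0 := by
    push_cast
    rw [ZMod.natCast_zmod_val, hj, sub_self]
  obtain ⟨k, hk⟩ := (ZMod.intCast_zmod_eq_zero_iff_dvd _ _).1 h1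
  have hk' : (j.val : ℝ) * p - i = q * k := by exact_mod_cast hk
  have hlt : y - i / q < 1 / q := by
    rw [sub_lt_iff_lt_add, ← add_div, lt_div_iff₀ hq, mul_comm, add_comm]
    exact Int.lt_floor_add_one _
  have hnn : 0 ≤ y - i / q := by
    rw [sub_nonneg, div_le_iff₀ hq, mul_comm]
    exact Int.floor_le _
  have hx : x = rotationPoint q θ ((p : ℝ) / q) j + ((y - i / q : ℝ) : UnitAddCircle) := by
    rw [← add_cwDist θ x, rotationPoint, add_assoc, ← AddCircle.coe_add]
    congr 1
    rw [UnitAddCircle.coe_eq_coe_iff]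
    refine ⟨-k, ?_⟩
    have : (j.val : ℝ) * (p / q) = i / q + k := by
      field_simp
      linarith
    rw [this]
    push_cast
    ring
  refine ⟨j, ?_⟩
  rw [(congrArg (cwDist _) hx).trans
    (cwDist_add_coe _ hnn (hlt.trans_le ((div_le_one hq).2 hq1)))]
  exact hlt

/-- The finitely many nonzero differences of indices, multiplied by `r`, stay at a positive distance
from the integers; `1 / m` is taken below all these distances. -/
theorem exists_disjointArcs_rotationPoint (M : ℕ) [NeZero M] (hr : Irrational r) :
    ∃ m : ℕ, 0 < m ∧ ∀ θ, DisjointArcs (rotationPoint M θ r) (1 / (m : ℝ)) := by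
  have h1 : ∀ d ∈ (Finset.univ : Finset (ZMod M × ZMod M)), d.1 ≠ d.2 → ∀ᶠ m : ℕ in atTop,
      ∀ k : ℤ, 1 / (m : ℝ) < |((d.1.val : ℝ) - d.2.val) * r - k| := by
    intro d _ hd
    have hne : ((d.1.val : ℤ) - d.2.val) ≠ 0 := by
      intro h
      exact hd (ZMod.val_injective M (by omega))
    have hirr := hr.intCast_mul hne
    have hpos : 0 < |(((d.1.val : ℤ) - d.2.val : ℤ) : ℝ) * r -
        round ((((d.1.val : ℤ) - d.2.val : ℤ) : ℝ) * r)| :=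
      abs_pos.2 (sub_ne_zero.2 (hirr.ne_int _))
    filter_upwards [tendsto_one_div_atTop_nhds_zero_nat.eventually (gt_mem_nhds hpos)] with m hm k
    refine hm.trans_le ?_
    have := round_le ((((d.1.val : ℤ) - d.2.val : ℤ) : ℝ) * r) k
    push_cast at this ⊢
    exact this
  have h2 : ∀ᶠ m : ℕ in atTop, ∀ d : ZMod M × ZMod M, d.1 ≠ d.2 →
      ∀ k : ℤ, 1 / (m : ℝ) < |((d.1.val : ℝ) - d.2.val) * r - k| := by
    simp only [eventually_all]
    exact fun d hd => by simpa using h1 d (Finset.mem_univ d) hd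
  obtain ⟨m, hm, hm0⟩ := (h2.and (eventually_gt_atTop 0)).exists
  have hm1 : 1 / (m : ℝ) ≤ 1 := by
    rw [div_le_one (by exact_mod_cast hm0)]
    exact_mod_cast hm0
  refine ⟨m, hm0, fun θ => ⟨hm1, fun j j' t t' h0 h1 h0' h1' h => ?_⟩⟩
  obtain ⟨k, hk⟩ := rotationPoint_add_eq_iff.1 h
  have hj : j = j' := by
    by_contra hne
    have h3 := hm (j, j') hne k
    have h4 : ((j.val : ℝ) - j'.val) * r - k = t' - t := by linarith
    simp only [h4] at h3
    rcases abs_cases (t' - t) with h5 | h5 <;> linarith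
  refine ⟨hj, ?_⟩
  subst hj
  have h3 : t - t' = k := by linarith
  have h4 : (k : ℝ) < 1 := by linarith
  have h5 : (-1 : ℝ) < k := by linarith
  have h4' : k < 1 := by exact_mod_cast h4
  have h5' : -1 < k := by exact_mod_cast h5
  have : k = 0 := by omega
  rw [this, Int.cast_zero] at h3
  linarith

open Classical in
-- For fixed `j` the `m` translates of the arc tile the circle, so exactly one contains `x`;
-- disjointness makes these translates distinct for distinct `j`.
theorem card_filter_exists_cwDist_lt {m : ℕ} [NeZero m]
    (H : ∀ θ, DisjointArcs (rotationPoint M θ r) (1 / (m : ℝ))) (x : UnitAddCircle) :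
    (Finset.univ.filter fun k : ZMod m => ∃ j : ZMod M,
      cwDist (rotationPoint M (rotationPoint m 0 (1 / (m : ℝ)) k) r j) x < 1 / (m : ℝ)).card = M := by
  have comm : ∀ (k : ZMod m) (j : ZMod M), rotationPoint M (rotationPoint m 0 (1 / (m : ℝ)) k) r j
      = rotationPoint m (rotationPoint M 0 r j) (((1 : ℕ) : ℝ) / m) k := by
    intro k j
    simp only [rotationPoint, zero_add, Nat.cast_one]
    rw [add_comm]
  have hex : ∀ j : ZMod M, ∃ k : ZMod m,
      cwDist (rotationPoint M (rotationPoint m 0 (1 / (m : ℝ)) k) r j) x < 1 / (m : ℝ) := by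
    intro j
    simp only [comm]
    exact exists_rotationPoint_rat_cwDist_lt (Nat.coprime_one_left m) x
  choose g hg using hex
  have hinj : Function.Injective g := by
    intro j j' h
    have h2 := hg j'
    rw [← h] at h2
    exact (H _).eq_of_cwDist_lt (hg j) h2
  have : (Finset.univ.filter fun k : ZMod m => ∃ j : ZMod M,
      cwDist (rotationPoint M (rotationPoint m 0 (1 / (m : ℝ)) k) r j) x < 1 / (m : ℝ))
      = Finset.univ.image g := by
    ext k
    simp only [Finset.mem_filter, Finset.mem_univ, true_and, Finset.mem_image]
    refine exists_congr fun j => ⟨fun h => ?_, fun h => h ▸ hg j⟩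
    have h2 := hg j
    rw [comm] at h h2
    exact ((disjointArcs_rotationPoint_rat (Nat.coprime_one_left m)).eq_of_cwDist_lt h h2).symm
  rw [this, Finset.card_image_of_injective _ hinj, Finset.card_univ, ZMod.card]

variable {ι : Type*} [Fintype ι] [DecidableEq ι]

theorem sum_card_arcIndices_inter {m : ℕ} [NeZero m]
    (H : ∀ θ, DisjointArcs (rotationPoint M θ r) (1 / (m : ℝ))) (u : ι → UnitAddCircle)
    (A : Finset ι) :
    ∑ k : ZMod m, ((arcIndices (rotationPoint M (rotationPoint m 0 (1 / (m : ℝ)) k) r)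
      (1 / (m : ℝ)) u ∩ A).card : ℝ) = M * A.card := by
  classical
  have h1 : ∀ k : ZMod m, ((arcIndices (rotationPoint M (rotationPoint m 0 (1 / (m : ℝ)) k) r)
      (1 / (m : ℝ)) u ∩ A).card : ℝ) = ∑ i ∈ A, if ∃ j : ZMod M,
      cwDist (rotationPoint M (rotationPoint m 0 (1 / (m : ℝ)) k) r j) (u i) < 1 / (m : ℝ)
      then 1 else 0 := by
    intro k
    rw [Finset.sum_boole]
    congr 2
    ext i
    simp [mem_arcIndices, and_comm]
  simp only [h1]
  rw [Finset.sum_comm]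
  simp only [Finset.sum_boole, card_filter_exists_cwDist_lt H]
  simp [mul_comm]

/-- The bound for one family is summed over its `m` translates, which count every point `M` times,
and then divided by `D * M`. Only site `0` needs refilling. -/
theorem integral_card_cycleIndices_le (hr1 : r ≤ 1) {m : ℕ} [NeZero m]
    (H : ∀ θ, DisjointArcs (rotationPoint M θ r) (1 / (m : ℝ))) {D : ℕ} (hD : 1 ≤ D)
    (hDM : D ≤ M) :
    ∫ u : ι → UnitAddCircle, ((cycleIndices r u).card : ℝ) ∂(Measure.pi fun _ => volume)
      ≤ Fintype.card ι * (1 / D + D ^ 2 / M) + m * D := by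
  have hM : (0 : ℝ) < M := by exact_mod_cast (NeZero.pos M)
  have hD0 : (0 : ℝ) < D := by exact_mod_cast hD
  have h1 := Finset.sum_le_sum fun (k : ZMod m) (_ : k ∈ Finset.univ) =>
    (H (rotationPoint m 0 (1 / (m : ℝ)) k)).integral_card_le (ι := ι) hr1 (B := {0})
      (fun j hj => rotationPoint_eq_of_ne_zero (by simpa using hj)) hD hDM
  rw [← Finset.mul_sum, Finset.sum_add_distrib, ← Finset.sum_mul,
    ← integral_finsetSum _ fun k _ => integrable_card_of_measurableSet_mem
      (DisjointArcs.measurableSet_mem_inter _ _ _),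
    ← integral_finsetSum _ fun k _ => integrable_card_of_measurableSet_mem
      (measurableSet_mem_arcIndices _ _)] at h1
  have h2 : ∀ u : ι → UnitAddCircle, ∑ k : ZMod m, ((arcIndices
      (rotationPoint M (rotationPoint m 0 (1 / (m : ℝ)) k) r) (1 / (m : ℝ)) u).card : ℝ)
      = M * Fintype.card ι := by
    intro u
    have := sum_card_arcIndices_inter H u Finset.univ
    simpa using this
  simp only [sum_card_arcIndices_inter H, h2, integral_const_mul, integral_const, probReal_univ,
    smul_eq_mul, one_mul, Finset.sum_const, Finset.card_univ, ZMod.card, nsmul_eq_mul,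
    Finset.card_singleton, Nat.cast_one, mul_one] at h1
  refine le_of_mul_le_mul_left ?_ (mul_pos hD0 hM)
  rw [mul_assoc]
  refine h1.trans (le_of_eq ?_)
  field_simp

end Arcs

/-! ### Passage to the limit -/

section Limit

theorem integral_numPeriodic {n : ℕ} {r : ℝ} (hr : 0 < r) {Ω : Type*} [MeasurableSpace Ω]
    {P : Measure Ω} [IsProbabilityMeasure P] {U : Fin n → Ω → UnitAddCircle}
    (hlaw : ∀ i, HasLaw (U i) (volume : Measure UnitAddCircle) P) (hindep : iIndepFun U P) :
    Integrable (fun ω => (numPeriodic (Set.range fun i => U i ω) hr : ℝ)) P ∧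
    ∫ ω, (numPeriodic (Set.range fun i => U i ω) hr : ℝ) ∂P
      = ∫ u : Fin n → UnitAddCircle, ((cycleIndices r u).card : ℝ)
        ∂(Measure.pi fun _ => volume) := by
  have hae : AEMeasurable (fun ω i => U i ω) P := aemeasurable_pi_lambda _ fun i =>
    (hlaw i).aemeasurable
  have hmap : P.map (fun ω i => U i ω) = Measure.pi fun _ => volume := by
    rw [(iIndepFun_iff_map_fun_eq_pi_map fun i => (hlaw i).aemeasurable).1 hindep]
    congr 1
    funext i
    exact (hlaw i).map_eq
  have hmeas := measurable_card_of_measurableSet_mem (measurableSet_mem_cycleIndices (ι := Fin n) r)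
  have hinj : ∀ᵐ ω ∂P, Function.Injective fun i => U i ω := by
    have := ae_injective (ι := Fin n)
    rw [← hmap] at this
    exact ae_of_ae_map hae this
  have heq : (fun ω => ((cycleIndices r fun i => U i ω).card : ℝ)) =ᵐ[P]
      fun ω => (numPeriodic (Set.range fun i => U i ω) hr : ℝ) := by
    filter_upwards [hinj] with ω hω
    rw [numPeriodic_range hr hω]
  have hint : Integrable (fun u : Fin n → UnitAddCircle => ((cycleIndices r u).card : ℝ))
      (P.map fun ω i => U i ω) := by
    rw [hmap]
    exact integrable_card_of_measurableSet_mem (measurableSet_mem_cycleIndices r)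
  refine ⟨(hint.comp_aemeasurable hae).congr heq, ?_⟩
  rw [← integral_congr_ae heq, ← hmap, integral_map hae hmeas.aestronglyMeasurable]

theorem integral_card_cycleIndices_rat_le {ι : Type*} [Fintype ι] [DecidableEq ι] {p q : ℕ}
    [NeZero q] (hpq : p.Coprime q) (hr1 : (p : ℝ) / q ≤ 1) :
    ∫ u : ι → UnitAddCircle, ((cycleIndices ((p : ℝ) / q) u).card : ℝ)
      ∂(Measure.pi fun _ => volume) ≤ Fintype.card ι / q + q ^ 3 := by
  have hq : (0 : ℝ) < q := by exact_mod_cast NeZero.pos q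
  have hq1 : (1 : ℝ) ≤ q := by exact_mod_cast NeZero.pos q
  have h := (disjointArcs_rotationPoint_rat (θ := 0) hpq).integral_card_le (ι := ι) hr1 (B := ∅)
    (fun j _ => rotationPoint_rat_eq j) (NeZero.pos q) le_rfl
  have huniv : ∀ u : ι → UnitAddCircle,
      arcIndices (rotationPoint q 0 ((p : ℝ) / q)) (1 / (q : ℝ)) u = Finset.univ := fun u =>
    Finset.eq_univ_iff_forall.2 fun i =>
      mem_arcIndices.2 (exists_rotationPoint_rat_cwDist_lt hpq (u i))
  simp only [huniv, Finset.univ_inter, integral_const, probReal_univ, smul_eq_mul, one_mul,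
    Finset.card_univ, Finset.card_empty, Nat.cast_zero, mul_zero, zero_div, add_zero,
    mul_one] at h
  refine le_of_mul_le_mul_left (h.trans ?_) hq
  rw [mul_add, mul_div_cancel₀ _ hq.ne']
  have : (q : ℝ) * q * q ≤ q * q ^ 3 := by nlinarith [sq_nonneg (q : ℝ), pow_pos hq 3]
  linarith

theorem tendsto_div_natCast_of_abs_sub_le {a : ℕ → ℝ} {L C : ℝ}
    (h : ∀ n : ℕ, |a n - n * L| ≤ C) : Tendsto (fun n : ℕ => a n / n) atTop (𝓝 L) := by
  rw [tendsto_iff_dist_tendsto_zero]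
  have h0 : Tendsto (fun n : ℕ => C / (n : ℝ)) atTop (𝓝 0) :=
    tendsto_const_div_atTop_nhds_zero_nat C
  refine squeeze_zero' (Eventually.of_forall fun n => dist_nonneg) ?_ h0
  filter_upwards [eventually_gt_atTop 0] with n hn
  have hn' : (0 : ℝ) < n := by exact_mod_cast hn
  rw [Real.dist_eq, div_sub' hn'.ne', abs_div, abs_of_pos hn']
  gcongr
  exact h n

theorem tendsto_div_natCast_zero {a : ℕ → ℝ} (h0 : ∀ n, 0 ≤ a n)
    (h : ∀ ε > 0, ∃ C, ∀ n : ℕ, a n ≤ n * ε + C) : Tendsto (fun n : ℕ => a n / n) atTop (𝓝 0) := by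
  rw [Metric.tendsto_atTop']
  intro ε hε
  obtain ⟨C, hC⟩ := h (ε / 2) (by positivity)
  have h1 := (tendsto_const_div_atTop_nhds_zero_nat C).eventually (gt_mem_nhds (half_pos hε))
  obtain ⟨N, hN⟩ := eventually_atTop.1 (h1.and (eventually_gt_atTop 0))
  refine ⟨N, fun n hn => ?_⟩
  obtain ⟨h2, h3⟩ := hN n hn.le
  have hn' : (0 : ℝ) < n := by exact_mod_cast h3
  rw [Real.dist_eq, sub_zero, abs_of_nonneg (div_nonneg (h0 n) hn'.le), div_lt_iff₀ hn']
  rw [div_lt_iff₀ hn'] at h2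
  have := hC n
  linarith

theorem exists_integral_card_cycleIndices_le {r : ℝ} (hr1 : r ≤ 1) (hirr : Irrational r) {ε : ℝ}
    (hε : 0 < ε) : ∃ C, ∀ n : ℕ, ∫ u : Fin n → UnitAddCircle, ((cycleIndices r u).card : ℝ)
      ∂(Measure.pi fun _ => volume) ≤ n * ε + C := by
  obtain ⟨D, hD⟩ := exists_nat_gt (2 / ε)
  have hD0 : (0 : ℝ) < D := lt_trans (by positivity) hD
  have hD1 : 1 ≤ D := by exact_mod_cast hD0
  have hne : NeZero (D ^ 3) := ⟨by positivity⟩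
  -- With `M = D ^ 3` the refilling term `D ^ 2 / M` is also `1 / D`, and `2 / D < ε`.
  obtain ⟨m, hm, H⟩ := exists_disjointArcs_rotationPoint (D ^ 3) hirr
  have : NeZero m := ⟨hm.ne'⟩
  refine ⟨m * D, fun n => ?_⟩
  refine (integral_card_cycleIndices_le hr1 H hD1 (Nat.le_self_pow (by norm_num) D)).trans ?_
  rw [Fintype.card_fin]
  gcongr
  push_cast
  have e : (1 : ℝ) / D + D ^ 2 / D ^ 3 = 2 / D := by
    field_simp
    norm_num
  rw [e]
  exact ((div_lt_comm₀ hε hD0).1 hD).le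

end Limit

/-- For each `n`, the points `U n 0, …, U n (n - 1)` are independent and uniform on the circle (on
a probability space that may depend on `n`), and the random set `X_n` is their range. -/
theorem theorem4p4 (r : ℝ) (hr : 0 < r) (hr1 : r ≤ 1)
    {Ω : ℕ → Type*} [∀ n, MeasurableSpace (Ω n)]
    (P : ∀ n, Measure (Ω n)) [∀ n, IsProbabilityMeasure (P n)]
    (U : ∀ n, Fin n → Ω n → UnitAddCircle)
    (hlaw : ∀ n i, HasLaw (U n i) (volume : Measure UnitAddCircle) (P n))
    (hindep : ∀ n, iIndepFun (U n) (P n)) :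
    (∀ n, Integrable (fun ω => (numPeriodic (Set.range fun i => U n i ω) hr : ℝ)) (P n)) ∧
    (Irrational r →
      Tendsto (fun n : ℕ =>
          (∫ ω, (numPeriodic (Set.range fun i => U n i ω) hr : ℝ) ∂(P n)) / (n : ℝ))
        atTop (𝓝 0)) ∧
    (∀ p q : ℕ, 0 < q → Nat.Coprime p q → r = (p : ℝ) / (q : ℝ) →
      Tendsto (fun n : ℕ =>
          (∫ ω, (numPeriodic (Set.range fun i => U n i ω) hr : ℝ) ∂(P n)) / (n : ℝ))
        atTop (𝓝 (1 / (q : ℝ)))) := by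

  refine ⟨fun n => (integral_numPeriodic hr (hlaw n) (hindep n)).1, fun hirr => ?_,
    fun p q hq hpq hrpq => ?_⟩
  · simp only [(integral_numPeriodic hr (hlaw _) (hindep _)).2]
    exact tendsto_div_natCast_zero (fun n => integral_nonneg fun u => by positivity)
      fun ε hε => exists_integral_card_cycleIndices_le hr1 hirr hε
  · subst hrpq
    have : NeZero q := ⟨hq.ne'⟩
    have hq0 : (0 : ℝ) < q := by exact_mod_cast hq
    simp only [(integral_numPeriodic hr (hlaw _) (hindep _)).2]
    refine tendsto_div_natCast_of_abs_sub_le (C := (q : ℝ) ^ 3) fun n => ?_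
    have h1 := integral_card_cycleIndices_rat_le (ι := Fin n) hpq hr1
    have hhr : 1 / (q : ℝ) ≤ (p : ℝ) / q := by
      have : 0 < p := by
        by_contra h0
        obtain rfl : p = 0 := by omega
        simp at hr
      gcongr
      exact_mod_cast this
    have h2 := (disjointArcs_rotationPoint_rat (θ := 0) hpq).le_integral_card (ι := Fin n) hr hr1
      hhr rotationPoint_rat_eq (exists_rotationPoint_rat_cwDist_lt hpq)
    rw [Fintype.card_fin] at h1 h2
    rw [mul_one_div, abs_le]
    constructor <;> linarith
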